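/- **Theorem 2.6.** Let $K$ be a field and let $G$ be a finite connected simple graph with vertex set $V$ and edge set $E(G)$. Let $A_G$ be the vertex-edge incidence matrix of $G$, and let $I_{A_G}\subset K[x_e : e\in E(G)]$ be its toric ideal, i.e. the kernel of the $K$-algebra homomorphism $\pi$ with $\pi(x_e)=t_it_j$ for $e=\{i,j\}$. A *binomial* is a difference $u-v$ of two distinct monomials; its support is the set of variables dividing $u$ or $v$. A *circuit* of $I_{A_G}$ is an irreducible binomial $f\in I_{A_G}$ such that no binomial of $I_{A_G}$ has support strictly contained in that of $f$. Let $C_{A_G}$ be the set of circuits and $C^{\rm sfsf}_{A_G}$ the set of circuits $u-v$ for which both $u$ and $v$ are squarefree. A binomial $f=u-v\in I_{A_G}$ is * *redundant* if it belongs to no (inclusion-)minimal system of binomial generators of $I_{A_G}$; * *indispensable* if every system of binomial generators of $I_{A_G}$ contains $f$ or $-f$; * *fundamental* if the toric ideal $I_{A_f}$ is generated by $f$, where $T_f$ is the set of the variables $t_i$ dividing $\pi(u)=\pi(v)$ and $A_f$ consists of the columns of $A_G$ belonging to the edges $e$ with $\pi(x_e)\in K[T_f]$; here $I_{A_f}=I_{A_G}\cap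 K[x_e : \pi(x_e)\in K[T_f]]$. Then the following conditions are equivalent: 1. (i) $I_{A_G}=\langle C^{\rm sfsf}_{A_G}\rangle$; 2. (ii) every circuit in $C_{A_G}\setminus C^{\rm sfsf}_{A_G}$ is redundant; 3. (iii) every circuit in $C_{A_G}\setminus C^{\rm sfsf}_{A_G}$ is not indispensable; 4. (iv) every circuit in $C_{A_G}\setminus C^{\rm sfsf}_{A_G}$ is not fundamental; 5. (v) there is no induced subgraph of $G$ consisting of two odd cycles $C_1$, $C_2$ having no common vertex and a path of length $\ge 1$ which connects a vertex of $C_1$ with a vertex of $C_2$ (and has no further vertex in common with $C_1$ or $C_2$). -/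

import Mathlib

namespace Toric

/-! ### Toric ideals of integer matrices

A configuration is given by an integer matrix `A` whose rows are indexed by `κ` (the Laurent
variables `t_i`) and whose columns are indexed by `ι` (the polynomial variables `x_j`). -/

section Matrices

variable {κ ι : Type*}

/-- The `K`-algebra homomorphism `π` from `K[x_j : j ∈ ι]` to the Laurent polynomial ring
`K[t_i, t_i⁻¹ : i ∈ κ]`, the group algebra of `κ → ℤ`, with `π (x_j) = T ^ a_j`
where `a_j` is the `j`-th column of `A`. -/
noncomputable def toricHom (K : Type*) [Field K] (A : Matrix κ ι ℤ) :
    MvPolynomial ι K →ₐ[K] AddMonoidAlgebra K (κ → ℤ) :=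
  MvPolynomial.aeval fun j => AddMonoidAlgebra.single (fun i => A i j) (1 : K)

/-- The toric ideal `I_A`, the kernel of `π`. -/
noncomputable def toricIdeal (K : Type*) [Field K] (A : Matrix κ ι ℤ) :
    Ideal (MvPolynomial ι K) :=
  RingHom.ker (toricHom K A)

variable {K : Type*} [Field K]

/-- The difference `X ^ u - X ^ v` of two monomials. -/
noncomputable def monomialDiff (K : Type*) [Field K] (u v : ι →₀ ℕ) : MvPolynomial ι K :=
  MvPolynomial.monomial u 1 - MvPolynomial.monomial v 1

/-- A binomial is the difference of two distinct monomials. -/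
def IsBinomial (f : MvPolynomial ι K) : Prop :=
  ∃ u v : ι →₀ ℕ, u ≠ v ∧ f = monomialDiff K u v

/-- `f` is a circuit of `I_A`: an irreducible binomial of `I_A` such that no binomial of `I_A` has
a strictly smaller support.  For a binomial `u - v` the set `vars` is `supp u ∪ supp v`. -/
def IsCircuit (A : Matrix κ ι ℤ) (f : MvPolynomial ι K) : Prop :=
  IsBinomial f ∧ f ∈ toricIdeal K A ∧ Irreducible f ∧
    ∀ g ∈ toricIdeal K A, IsBinomial g → ¬ g.vars ⊂ f.vars

/-- The monomial `X ^ u` is squarefree. -/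
def SquarefreeExponent (u : ι →₀ ℕ) : Prop :=
  ∀ j, u j ≤ 1

/-- The set `C_A` of all circuits of `I_A`. -/
def circuits (K : Type*) [Field K] (A : Matrix κ ι ℤ) : Set (MvPolynomial ι K) :=
  {f | IsCircuit A f}

/-- The set of those circuits `X ^ u - X ^ v` of `I_A` for which both `X ^ u` and `X ^ v` are
squarefree. -/
def squarefreeCircuits (K : Type*) [Field K] (A : Matrix κ ι ℤ) : Set (MvPolynomial ι K) :=
  {f | f ∈ circuits K A ∧ ∃ u v : ι →₀ ℕ,
    f = monomialDiff K u v ∧ SquarefreeExponent u ∧ SquarefreeExponent v}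

/-- `F` is a system of binomial generators of `I_A`. -/
def IsBinomialGenerators (A : Matrix κ ι ℤ) (F : Set (MvPolynomial ι K)) : Prop :=
  (∀ f ∈ F, IsBinomial f) ∧ Ideal.span F = toricIdeal K A

/-- `f` is redundant: it belongs to no minimal system of binomial generators of `I_A`, where
minimality is with respect to inclusion. -/
def IsRedundant (A : Matrix κ ι ℤ) (f : MvPolynomial ι K) : Prop :=
  ¬ ∃ F : Set (MvPolynomial ι K), Minimal (IsBinomialGenerators A) F ∧ f ∈ F

/-- `f` is indispensable: it is a binomial of `I_A` and every system of binomial generators of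
`I_A` contains `f` or `-f`. -/
def IsIndispensable (A : Matrix κ ι ℤ) (f : MvPolynomial ι K) : Prop :=
  IsBinomial f ∧ f ∈ toricIdeal K A ∧
    ∀ F : Set (MvPolynomial ι K), IsBinomialGenerators A F → f ∈ F ∨ -f ∈ F

/-- The exponent vector of the Laurent monomial `π (X ^ u)`. -/
def multidegree (A : Matrix κ ι ℤ) (u : ι →₀ ℕ) : κ → ℤ :=
  fun i => u.sum fun j n => (n : ℤ) * A i j

/-- The set of those `i` for which the variable `t_i` divides the monomial `π (X ^ u)`
(used for matrices with nonnegative entries). -/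
def dividingVars (A : Matrix κ ι ℤ) (u : ι →₀ ℕ) : Set κ :=
  {i | 1 ≤ multidegree A u i}

/-- The set of those columns `a_j` of `A` for which `T ^ a_j` lies in the polynomial ring
`K[t_i : i ∈ S]`. -/
def columnsIn (A : Matrix κ ι ℤ) (S : Set κ) : Set ι :=
  {j | ∀ i, 0 ≤ A i j ∧ (A i j ≠ 0 → i ∈ S)}

/-- `f = X ^ u - X ^ v` is fundamental: it is a binomial of `I_A`, and if `A_f` denotes the matrix
of those columns of `A` whose Laurent monomials lie in `K[t_i : t_i divides π (X ^ u)]`, then the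
toric ideal of `A_f` (an ideal of the polynomial ring in the corresponding variables) is
generated by `f`. -/
def IsFundamental (A : Matrix κ ι ℤ) (f : MvPolynomial ι K) : Prop :=
  f ∈ toricIdeal K A ∧ ∃ u v : ι →₀ ℕ, u ≠ v ∧ f = monomialDiff K u v ∧
    ∃ f' : MvPolynomial (columnsIn A (dividingVars A u)) K,
      MvPolynomial.rename Subtype.val f' = f ∧
      toricIdeal K (A.submatrix id
        (Subtype.val : columnsIn A (dividingVars A u) → ι)) = Ideal.span {f'}

end Matrices

/-! ### Graphs -/

section Graphs

variable {V : Type*}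

open Classical in
/-- The matrix `A_G`: the vertex-edge incidence matrix of `G`, with one column for each edge. -/
noncomputable def graphMatrix (G : SimpleGraph V) : Matrix V G.edgeSet ℤ :=
  (G.incMatrix ℤ).submatrix id Subtype.val

/-- The subgraph `H` of `G` consists of two odd cycles without common vertex and a path of length
at least `1` which connects a vertex `a` of the first cycle with a vertex `b` of the second one;
the path meets the first cycle only in `a` and the second one only in `b`. -/
def IsOddCyclesWithPath {G : SimpleGraph V} (H : G.Subgraph) : Prop :=
  ∃ (a b : V) (c₁ : G.Walk a a) (c₂ : G.Walk b b) (p : G.Walk a b),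
    c₁.IsCycle ∧ Odd c₁.length ∧ c₂.IsCycle ∧ Odd c₂.length ∧
    (∀ x ∈ c₁.support, x ∉ c₂.support) ∧
    p.IsPath ∧ 1 ≤ p.length ∧
    (∀ x ∈ p.support, x ∈ c₁.support → x = a) ∧
    (∀ x ∈ p.support, x ∈ c₂.support → x = b) ∧
    H = c₁.toSubgraph ⊔ p.toSubgraph ⊔ c₂.toSubgraph

end Graphs

end Toric

/-! The implications proved are 5 → 1 → 3 → 4 → 5 and 5 → 2 → 3.

From 5, call a pair `u`, `v` of equal multidegree `Unlinked` if no `w` in its fibre shares a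
variable with both. A linked pair satisfies `u - v = (u - w) + (w - v)`, and each summand is a
variable times a binomial of smaller degree (`exists_link`). Induction on the degree therefore
reduces 1 to unlinked pairs. A circuit that is not squarefree turns out to be linked, so it lies in
the ideal of smaller-degree binomials and can be dropped from any generating system, which gives 2.

An unlinked pair contains no proper nonempty balanced subpair (`Unlinked.eq_of_le`). At a vertex `a`
of degree at least two it therefore splits into two odd alternating closed walks that meet only in
`a`, with no edge of `G` joining their other vertices. If there is at most one such vertex, the pair
is a squarefree circuit (`Unlinked.mem_squarefreeCircuits`). If there are two, `a` and `b`, each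
cuts off a side containing an odd closed walk but not the other vertex, and these sides are
disjoint. A shortest configuration of an odd closed walk in each side and a connecting walk is then
an induced subgraph of the forbidden kind (`exists_isInduced_isOddCyclesWithPath`).

For 4 → 5, the relations between the edges of such an induced subgraph form a group of rank one. The
generator has entries of absolute value two on the path, and inducedness makes these edges exactly
the columns of `A_f`; hence the circuit is fundamental
(`exists_isFundamental_of_isOddCyclesWithPath`). For 3 → 4, the fibre of a fundamental binomial
consists of its two monomials only, so it is indispensable. -/

namespace Toric

/-! ### Toric ideals: binomial generators, grading by multidegree, circuits, indispensability. -/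

section ToricAlgebra

open MvPolynomial

variable {κ ι : Type*} {K : Type*} [Field K] {A : Matrix κ ι ℤ}

lemma multidegree_add (u v : ι →₀ ℕ) :
    multidegree A (u + v) = multidegree A u + multidegree A v := by
  classical
  funext i
  simp only [multidegree, Pi.add_apply]
  exact Finsupp.sum_add_index' (by simp) (by intros; push_cast; ring)

lemma multidegree_zero : multidegree A (0 : ι →₀ ℕ) = 0 := by
  funext i
  simp [multidegree]

lemma multidegree_single (j : ι) (n : ℕ) (i : κ) :
    multidegree A (Finsupp.single j n) i = n * A i j := by
  simp [multidegree]

lemma toricHom_monomial (u : ι →₀ ℕ) (c : K) :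
    toricHom K A (monomial u c) = AddMonoidAlgebra.single (multidegree A u) c := by
  induction u using Finsupp.induction_linear generalizing c with
  | zero =>
    rw [multidegree_zero, monomial_zero', toricHom, aeval_C]
    rfl
  | add u v hu hv =>
    rw [← mul_one c, ← monomial_mul, map_mul, hu, hv, AddMonoidAlgebra.single_mul_single,
      multidegree_add]
  | single j n =>
    rw [toricHom, aeval_monomial, Finsupp.prod_single_index (by simp),
      AddMonoidAlgebra.single_pow, one_pow, AddMonoidAlgebra.coe_algebraMap, Function.comp_apply,
      AddMonoidAlgebra.single_mul_single, zero_add]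
    congr 1
    · funext i
      simp [multidegree_single]
    · simp

lemma monomialDiff_mem_iff {u v : ι →₀ ℕ} :
    monomialDiff K u v ∈ toricIdeal K A ↔ multidegree A u = multidegree A v := by
  rw [toricIdeal, RingHom.mem_ker, monomialDiff]
  change toricHom K A _ = 0 ↔ _
  rw [map_sub, toricHom_monomial, toricHom_monomial, sub_eq_zero]
  constructor
  · intro h
    exact AddMonoidAlgebra.single_left_injective (R := K) one_ne_zero h
  · intro h
    rw [h]

lemma neg_monomialDiff (u v : ι →₀ ℕ) : -monomialDiff K u v = monomialDiff K v u := by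
  simp [monomialDiff]

lemma monomial_mul_monomialDiff (m u v : ι →₀ ℕ) :
    monomial m 1 * monomialDiff K u v = monomialDiff K (m + u) (m + v) := by
  simp [monomialDiff, mul_sub, monomial_mul]

lemma coeff_monomialDiff [DecidableEq ι] (u v w : ι →₀ ℕ) :
    coeff w (monomialDiff K u v) = (if u = w then 1 else 0) - (if v = w then 1 else 0) := by
  rw [monomialDiff, coeff_sub, coeff_monomial, coeff_monomial]

lemma monomialDiff_ne_zero {u v : ι →₀ ℕ} (h : u ≠ v) : monomialDiff K u v ≠ 0 := by
  classical
  intro h0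
  have := coeff_monomialDiff (K := K) u v u
  rw [h0, if_pos rfl, if_neg h.symm] at this
  simp at this

lemma support_monomialDiff [DecidableEq ι] {u v : ι →₀ ℕ} (h : u ≠ v) :
    (monomialDiff K u v).support = {u, v} := by
  ext w
  rw [mem_support_iff, coeff_monomialDiff]
  by_cases h1 : u = w
  · subst h1
    simp [h.symm]
  · by_cases h2 : v = w
    · subst h2
      simp [h]
    · simp [h1, h2, Ne.symm h1, Ne.symm h2]

lemma monomialDiff_eq_iff {u v p q : ι →₀ ℕ} (h : u ≠ v)
    (he : monomialDiff K u v = monomialDiff K p q) : (p = u ∧ q = v) ∨ (p = v ∧ q = u) := by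
  classical
  have hpq : p ≠ q := by
    rintro rfl
    apply monomialDiff_ne_zero (K := K) h
    rw [he]
    simp [monomialDiff]
  have h1 := support_monomialDiff (K := K) h
  rw [he, support_monomialDiff hpq] at h1
  have h2 : p ∈ ({u, v} : Finset (ι →₀ ℕ)) := h1 ▸ (by simp)
  have h3 : q ∈ ({u, v} : Finset (ι →₀ ℕ)) := h1 ▸ (by simp)
  simp only [Finset.mem_insert, Finset.mem_singleton] at h2 h3
  rcases h2 with rfl | rfl <;> rcases h3 with rfl | rfl <;> simp_all

lemma vars_monomialDiff [DecidableEq ι] {u v : ι →₀ ℕ} (h : u ≠ v) :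
    (monomialDiff K u v).vars = u.support ∪ v.support := by
  ext i
  rw [mem_vars_iff_mem_support, support_monomialDiff h]
  simp

lemma totalDegree_monomialDiff {u v : ι →₀ ℕ} (h : u ≠ v) (hd : u.degree = v.degree) :
    (monomialDiff K u v).totalDegree = u.degree := by
  classical
  rw [totalDegree, support_monomialDiff h]
  have (w : ι →₀ ℕ) : (w.sum fun _ e => e) = w.degree := rfl
  simp [this, hd]

lemma rename_monomialDiff {ι' : Type*} (g : ι' → ι) (u v : ι' →₀ ℕ) :
    rename g (monomialDiff K u v) = monomialDiff K (u.mapDomain g) (v.mapDomain g) := by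
  simp [monomialDiff, rename_monomial]

variable (K A) in
/-- The binomials `X ^ u - X ^ v` with `π (X ^ u) = π (X ^ v)`. -/
def homogeneousBinomials : Set (MvPolynomial ι K) :=
  {f | ∃ u v : ι →₀ ℕ, u ≠ v ∧ multidegree A u = multidegree A v ∧ f = monomialDiff K u v}

/-- Modulo these binomials every monomial equals a chosen representative of its fibre, so a
polynomial is congruent to a lift of its image under `toricHom`; for an element of the kernel this
lift is zero. -/
lemma isBinomialGenerators_homogeneousBinomials :
    IsBinomialGenerators A (homogeneousBinomials K A) := by
  classical
  refine ⟨fun f ⟨u, v, h, _, he⟩ => ⟨u, v, h, he⟩, le_antisymm ?_ ?_⟩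
  · rw [Ideal.span_le]
    rintro f ⟨u, v, _, h, rfl⟩
    exact monomialDiff_mem_iff.2 h
  -- A choice of one monomial in each nonempty fibre; the default 0 is never evaluated on a
  -- multidegree that occurs.
  · let s : (κ → ℤ) → (ι →₀ ℕ) := fun b =>
      if h : ∃ u, multidegree A u = b then h.choose else 0
    have hs : ∀ u, multidegree A (s (multidegree A u)) = multidegree A u := fun u => by
      have h : ∃ w, multidegree A w = multidegree A u := ⟨u, rfl⟩
      simp only [s, dif_pos h]
      exact h.choose_spec
    let L : AddMonoidAlgebra K (κ → ℤ) → MvPolynomial ι K := fun g =>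
      g.coeff.sum fun b c => monomial (s b) c
    have hL : ∀ g g', L (g + g') = L g + L g' := fun g g' => by
      simp only [L, AddMonoidAlgebra.coeff_add]
      exact Finsupp.sum_add_index' (by simp) (by simp)
    have key : ∀ f : MvPolynomial ι K,
        f - L (toricHom K A f) ∈ Ideal.span (homogeneousBinomials K A) := by
      intro f
      induction f using MvPolynomial.induction_on' with
      | monomial u c =>
        rw [toricHom_monomial]
        have : L (AddMonoidAlgebra.single (multidegree A u) c) =
            monomial (s (multidegree A u)) c := by
          simp [L, AddMonoidAlgebra.coeff_single]
        rw [this]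
        have h2 : monomial u c - monomial (s (multidegree A u)) c =
            C c * monomialDiff K u (s (multidegree A u)) := by
          simp [monomialDiff, mul_sub, C_mul_monomial]
        rw [h2]
        apply Ideal.mul_mem_left
        by_cases h : u = s (multidegree A u)
        · rw [← h]
          simp [monomialDiff]
        · exact Ideal.subset_span ⟨u, _, h, (hs u).symm, rfl⟩
      | add p q hp hq =>
        rw [map_add, hL, add_sub_add_comm]
        exact add_mem hp hq
    intro f hf
    have h := key f
    have h0 : toricHom K A f = 0 := hf
    rw [h0] at h
    have : L 0 = 0 := by simp [L]
    rwa [this, sub_zero] at h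

open Classical in
variable (K A) in
/-- The projection of the polynomial ring onto its component of multidegree `b`. -/
noncomputable def component (b : κ → ℤ) : MvPolynomial ι K →ₗ[K] MvPolynomial ι K :=
  (basisMonomials ι K).constr K fun u => if multidegree A u = b then monomial u 1 else 0

open Classical in
lemma component_monomial (b : κ → ℤ) (u : ι →₀ ℕ) (c : K) :
    component K A b (monomial u c) = if multidegree A u = b then monomial u c else 0 := by
  have h : monomial u c = c • basisMonomials ι K u := by
    rw [coe_basisMonomials, smul_monomial, smul_eq_mul, mul_one]
  rw [h, map_smul, component, Module.Basis.constr_basis, coe_basisMonomials]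
  simp

/-- An element of the ideal generated by a set `F` of binomials of a toric ideal which is
homogeneous of multidegree `b` already lies in the ideal generated by those elements of `F` whose
multidegree divides `b`. -/
lemma mem_span_of_multidegree {F : Set (MvPolynomial ι K)} (hF : ∀ g ∈ F, IsBinomial g)
    (hI : F ⊆ toricIdeal K A) {u v : ι →₀ ℕ} (huv : multidegree A u = multidegree A v)
    (hf : monomialDiff K u v ∈ Ideal.span F) :
    monomialDiff K u v ∈ Ideal.span {g ∈ F | ∃ p q m : ι →₀ ℕ, p ≠ q ∧ g = monomialDiff K p q ∧
      multidegree A p = multidegree A q ∧ multidegree A (m + p) = multidegree A u} := by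
  classical
  set T := {g ∈ F | ∃ p q m : ι →₀ ℕ, p ≠ q ∧ g = monomialDiff K p q ∧
      multidegree A p = multidegree A q ∧ multidegree A (m + p) = multidegree A u} with hT
  -- The multiplier `a` is kept general because the projection is only `K`-linear; the scalar case
  -- of the induction absorbs the coefficient into it.
  have key : ∀ f ∈ Ideal.span F, ∀ a,
      component K A (multidegree A u) (a * f) ∈ Ideal.span T := by
    intro f hf
    induction hf using Submodule.span_induction with
    | mem g hg =>
      intro a
      obtain ⟨p, q, hpq, rfl⟩ := hF g hg
      have hd : multidegree A p = multidegree A q := monomialDiff_mem_iff.1 (hI hg)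
      induction a using MvPolynomial.induction_on' with
      | monomial m c =>
        have h1 : monomial m c * monomialDiff K p q =
            monomial (m + p) c - monomial (m + q) c := by
          simp [monomialDiff, mul_sub, monomial_mul]
        have h2 : multidegree A (m + q) = multidegree A (m + p) := by
          rw [multidegree_add, multidegree_add, hd]
        rw [h1, map_sub, component_monomial, component_monomial, h2]
        split_ifs with h
        · rw [← h1]
          exact Ideal.mul_mem_left _ _ (Ideal.subset_span ⟨hg, p, q, m, hpq, rfl, hd, h⟩)
        · simp
      | add a b ha hb =>
        rw [add_mul, map_add]
        exact add_mem ha hb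
    | zero => intro a; simp
    | add x y _ _ hx hy =>
      intro a
      rw [mul_add, map_add]
      exact add_mem (hx a) (hy a)
    | smul c x _ hx =>
      intro a
      rw [smul_eq_mul, ← mul_assoc]
      exact hx _
  have h := key _ hf 1
  rw [one_mul] at h
  nth_rewrite 1 [monomialDiff] at h
  rw [map_sub, component_monomial, component_monomial, if_pos rfl, if_pos huv.symm] at h
  exact h

/-- If every relation between the columns is a multiple of `u - v`, the toric ideal is principal. -/
lemma toricIdeal_eq_span_singleton {u v : ι →₀ ℕ} (hdisj : ∀ j, u j = 0 ∨ v j = 0)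
    (huv : multidegree A u = multidegree A v)
    (hker : ∀ p q : ι →₀ ℕ, multidegree A p = multidegree A q →
      ∃ k : ℤ, ∀ j, (p j : ℤ) - q j = k * (u j - v j)) :
    toricIdeal K A = Ideal.span {monomialDiff K u v} := by
  apply le_antisymm
  · rw [← isBinomialGenerators_homogeneousBinomials.2, Ideal.span_le]
    -- Disjointness of the supports lets `X ^ (k • u)` split off from `X ^ p`, leaving a common
    -- cofactor times `(X ^ u) ^ k - (X ^ v) ^ k`, which `X ^ u - X ^ v` divides.
    have main : ∀ p q : ι →₀ ℕ, ∀ k : ℕ, (∀ j, (p j : ℤ) - q j = k * (u j - v j)) →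
        monomialDiff K p q ∈ Ideal.span {monomialDiff K u v} := by
      intro p q k hk
      have hle : k • u ≤ p := by
        intro j
        have h1 := hk j
        rcases hdisj j with h | h
        · simp [h]
        · rw [h] at h1
          simp only [Finsupp.smul_apply, smul_eq_mul]
          push_cast at h1
          zify
          linarith [Int.natCast_nonneg (q j)]
      obtain ⟨m, rfl⟩ := exists_add_of_le hle
      have hq : q = m + k • v := by
        ext j
        have h1 := hk j
        simp only [Finsupp.add_apply, Finsupp.smul_apply, smul_eq_mul] at h1 ⊢
        push_cast at h1
        zify
        linarith
      rw [hq, add_comm (k • u), ← monomial_mul_monomialDiff]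
      apply Ideal.mul_mem_left
      rw [Ideal.mem_span_singleton]
      have : monomialDiff K (k • u) (k • v) = (monomial u 1) ^ k - (monomial v (1 : K)) ^ k := by
        simp [monomialDiff, monomial_pow]
      rw [this]
      exact sub_dvd_pow_sub_pow _ _ k
    rintro f ⟨p, q, hpq, hd, rfl⟩
    obtain ⟨k, hk⟩ := hker p q hd
    rcases Int.eq_nat_or_neg k with ⟨n, rfl | rfl⟩
    · exact main p q n hk
    · rw [SetLike.mem_coe, ← neg_monomialDiff q p]
      refine neg_mem (main q p n fun j => ?_)
      linarith [hk j]
  · rw [Ideal.span_le, Set.singleton_subset_iff]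
    exact monomialDiff_mem_iff.2 huv

lemma toricIdeal_isPrime : (toricIdeal K A).IsPrime := RingHom.ker_isPrime _

lemma multidegree_mapDomain (T : Set ι) (p : T →₀ ℕ) :
    multidegree A (p.mapDomain Subtype.val) =
      multidegree (A.submatrix id (Subtype.val : T → ι)) p := by
  funext i
  rw [multidegree, multidegree, Finsupp.sum_mapDomain_index (by simp) (by intros; push_cast; ring)]
  rfl

lemma exists_mapDomain_eq {T : Set ι} {p : ι →₀ ℕ} (h : ∀ j, p j ≠ 0 → j ∈ T) :
    ∃ p' : T →₀ ℕ, p'.mapDomain Subtype.val = p := by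
  classical
  refine ⟨p.comapDomain Subtype.val Subtype.val_injective.injOn,
    Finsupp.mapDomain_comapDomain _ Subtype.val_injective _ ?_⟩
  intro j hj
  simp only [Subtype.range_coe_subtype]
  exact h j (by simpa using hj)

/-- If the relations between the columns in `T` are the multiples of `u - v`, then the toric ideal
of these columns is generated by `X ^ u - X ^ v`. -/
lemma toricIdeal_submatrix_eq_span {T : Set ι} {u v : ι →₀ ℕ} (hu : ∀ j, u j ≠ 0 → j ∈ T)
    (hv : ∀ j, v j ≠ 0 → j ∈ T) (hdisj : ∀ j, u j = 0 ∨ v j = 0)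
    (huv : multidegree A u = multidegree A v)
    (hker : ∀ p q : ι →₀ ℕ, (∀ j, p j ≠ 0 → j ∈ T) → (∀ j, q j ≠ 0 → j ∈ T) →
      multidegree A p = multidegree A q → ∃ k : ℤ, ∀ j, (p j : ℤ) - q j = k * (u j - v j)) :
    ∃ f' : MvPolynomial T K, rename Subtype.val f' = monomialDiff K u v ∧
      toricIdeal K (A.submatrix id (Subtype.val : T → ι)) = Ideal.span {f'} := by
  obtain ⟨u', rfl⟩ := exists_mapDomain_eq hu
  obtain ⟨v', rfl⟩ := exists_mapDomain_eq hv
  have hval (p : T →₀ ℕ) (j : T) : p.mapDomain Subtype.val (j : ι) = p j :=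
    Finsupp.mapDomain_apply Subtype.val_injective p j
  have hT (p : T →₀ ℕ) (j : ι) (hj : p.mapDomain Subtype.val j ≠ 0) : j ∈ T := by
    by_contra h
    exact hj (Finsupp.mapDomain_of_notMem_range p j (by simpa using h))
  refine ⟨monomialDiff K u' v', rename_monomialDiff _ _ _, toricIdeal_eq_span_singleton ?_ ?_ ?_⟩
  · intro j
    simpa [hval] using hdisj j
  · simpa [multidegree_mapDomain] using huv
  · intro p q hpq
    obtain ⟨k, hk⟩ := hker (p.mapDomain Subtype.val) (q.mapDomain Subtype.val) (hT p) (hT q)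
      (by simpa [multidegree_mapDomain] using hpq)
    exact ⟨k, fun j => by simpa [hval] using hk j⟩

/-- Over the columns in `T` the binomial generates a toric, hence prime, ideal; it is thus prime
there and remains so in the larger polynomial ring. Support minimality holds because a nonzero
multiple of `u - v` has full support. -/
lemma isCircuit_monomialDiff {T : Set ι} {u v : ι →₀ ℕ} (hne : u ≠ v)
    (hu : ∀ j, u j ≠ 0 → j ∈ T) (hv : ∀ j, v j ≠ 0 → j ∈ T) (hdisj : ∀ j, u j = 0 ∨ v j = 0)
    (huv : multidegree A u = multidegree A v)
    (hker : ∀ p q : ι →₀ ℕ, (∀ j, p j ≠ 0 → j ∈ T) → (∀ j, q j ≠ 0 → j ∈ T) →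
      multidegree A p = multidegree A q → ∃ k : ℤ, ∀ j, (p j : ℤ) - q j = k * (u j - v j)) :
    IsCircuit A (monomialDiff K u v) := by
  classical
  refine ⟨⟨u, v, hne, rfl⟩, monomialDiff_mem_iff.2 huv, ?_, ?_⟩
  · obtain ⟨f', hf', hspan⟩ := toricIdeal_submatrix_eq_span (K := K) hu hv hdisj huv hker
    have h0 : f' ≠ 0 := by
      rintro rfl
      rw [map_zero] at hf'
      exact monomialDiff_ne_zero hne hf'.symm
    have hp : Prime f' := by
      rw [← Ideal.span_singleton_prime h0, ← hspan]
      exact toricIdeal_isPrime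
    rw [← hf']
    exact ((prime_rename_iff T).2 hp).irreducible
  · rintro _ hmem ⟨p, q, hpq, rfl⟩ hss
    rw [vars_monomialDiff hpq, vars_monomialDiff hne] at hss
    have hsub : ∀ j, p j ≠ 0 ∨ q j ≠ 0 → j ∈ T := by
      intro j hj
      have := Finset.mem_of_subset hss.subset (by simpa using hj : j ∈ p.support ∪ q.support)
      simp only [Finset.mem_union, Finsupp.mem_support_iff] at this
      exact this.elim (hu j) (hv j)
    obtain ⟨k, hk⟩ := hker p q (fun j hj => hsub j (.inl hj)) (fun j hj => hsub j (.inr hj))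
      (monomialDiff_mem_iff.1 hmem)
    have hk0 : k ≠ 0 := by
      rintro rfl
      apply hpq
      ext j
      have := hk j
      rw [zero_mul] at this
      omega
    apply hss.2
    intro j hj
    by_contra h
    simp only [Finset.mem_union, Finsupp.mem_support_iff, not_or, not_not] at h hj
    have h1 := hk j
    rw [h.1, h.2, sub_self, eq_comm, mul_eq_zero, or_iff_right hk0] at h1
    have := hdisj j
    omega

/-- An indispensable binomial belongs to a minimal system of binomial generators. -/
lemma IsIndispensable.not_isRedundant [Finite ι] {f : MvPolynomial ι K}
    (hf : IsIndispensable A f) : ¬ IsRedundant A f := by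
  classical
  obtain ⟨hb, hI, hall⟩ := hf
  have hB := isBinomialGenerators_homogeneousBinomials (K := K) (A := A)
  -- Noetherianity supplies a finite binomial generating set, and a finite set contains a minimal
  -- generating subset.
  have hfg : (Ideal.span (homogeneousBinomials K A)).FG := IsNoetherian.noetherian _
  obtain ⟨s, hs, hspan⟩ := (Submodule.fg_span_iff_fg_span_finset_subset _).1 hfg
  have hs' : IsBinomialGenerators A (s : Set (MvPolynomial ι K)) :=
    ⟨fun g hg => hB.1 g (hs hg), by rw [← hB.2]; exact hspan.symm⟩
  obtain ⟨t, hts, ht⟩ := (s.powerset.filter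
    fun t : Finset _ => IsBinomialGenerators A (t : Set (MvPolynomial ι K))).exists_le_minimal
      (a := s) (by simpa using hs')
  simp only [Finset.mem_filter, Finset.mem_powerset] at ht
  have htmin : Minimal (IsBinomialGenerators A) (t : Set (MvPolynomial ι K)) := by
    refine ⟨ht.1.2, fun F hF hFt => ?_⟩
    have hfin : F.Finite := t.finite_toSet.subset hFt
    obtain ⟨t', rfl⟩ := hfin.exists_finset_coe
    have h1 : t' ⊆ t := by exact_mod_cast hFt
    exact_mod_cast ht.2 ⟨h1.trans hts, hF⟩ h1
  rw [IsRedundant, not_not]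
  rcases hall _ ht.1.2 with h | h
  · exact ⟨_, htmin, h⟩
  -- If only `-f` occurs in the minimal system, negating the whole system gives a minimal one
  -- containing `f`.
  · have hneg : ∀ F : Set (MvPolynomial ι K), IsBinomialGenerators A F →
        IsBinomialGenerators A (-F) := by
      rintro F ⟨h1, h2⟩
      refine ⟨fun g hg => ?_, ?_⟩
      · obtain ⟨u, v, huv, he⟩ := h1 _ hg
        exact ⟨v, u, huv.symm, by rw [← neg_monomialDiff, ← he, neg_neg]⟩
      · rw [← h2]
        exact Submodule.span_neg F
    refine ⟨-(t : Set (MvPolynomial ι K)), ⟨hneg _ htmin.1, fun F hF hle => ?_⟩, by simpa using h⟩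
    have := htmin.2 (hneg F hF) (by intro x hx; simpa using hle hx)
    intro x hx
    simpa using this hx

/-- A binomial lying in the ideal generated by binomials of the toric ideal of smaller total degree
is redundant, provided that the total degree is determined by the multidegree. -/
lemma isRedundant_of_mem_span {u v : ι →₀ ℕ}
    (hA : ∀ p q : ι →₀ ℕ, multidegree A p = multidegree A q → p.degree = q.degree)
    (hne : u ≠ v) (hmem : monomialDiff K u v ∈ Ideal.span {g | ∃ p q : ι →₀ ℕ,
      multidegree A p = multidegree A q ∧ p.degree < u.degree ∧ g = monomialDiff K p q}) :
    IsRedundant A (monomialDiff K u v) := by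
  rintro ⟨F, hF, hfF⟩
  have hFI : F ⊆ toricIdeal K A := by
    rw [← hF.1.2]
    exact Ideal.subset_span
  have huv : multidegree A u = multidegree A v := monomialDiff_mem_iff.1 (hFI hfF)
  have h1 : monomialDiff K u v ∈ Ideal.span (F \ {monomialDiff K u v}) := by
    refine Ideal.span_le.2 ?_ hmem
    rintro _ ⟨p, q, hpq, hdeg, rfl⟩
    -- By homogeneity only members of `F` of degree at most `p.degree < u.degree` are needed, and `u
    -- - v` is not among these.
    have hp : monomialDiff K p q ∈ Ideal.span F := by
      rw [hF.1.2]
      exact monomialDiff_mem_iff.2 hpq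
    refine Ideal.span_mono ?_ (mem_span_of_multidegree hF.1.1 hFI hpq hp)
    rintro _ ⟨hgF, r, s, m, hrs, rfl, hd, hm⟩
    refine ⟨hgF, fun h => ?_⟩
    have h2 : m.degree + r.degree = p.degree := by
      rw [← map_add]
      exact hA _ _ hm
    rcases monomialDiff_eq_iff hne h.symm with ⟨rfl, rfl⟩ | ⟨rfl, rfl⟩
    · omega
    · have := hA _ _ huv
      omega
  have h2 : IsBinomialGenerators A (F \ {monomialDiff K u v}) := by
    refine ⟨fun g hg => hF.1.1 g hg.1, le_antisymm ?_ ?_⟩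
    · rw [← hF.1.2]
      exact Ideal.span_mono Set.sdiff_subset
    · rw [← hF.1.2, Ideal.span_le]
      intro g hg
      by_cases h : g = monomialDiff K u v
      · rw [h]
        exact h1
      · exact Ideal.subset_span ⟨hg, h⟩
  exact (hF.2 h2 Set.sdiff_subset hfF).2 rfl

/-- Fundamental binomials are indispensable, provided that the entries of the matrix are nonnegative
and that the total degree is determined by the multidegree. -/
lemma IsFundamental.isIndispensable {f : MvPolynomial ι K} (hpos : ∀ i j, 0 ≤ A i j)
    (hA : ∀ p q : ι →₀ ℕ, multidegree A p = multidegree A q → p.degree = q.degree)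
    (hf : IsFundamental A f) : IsIndispensable A f := by
  obtain ⟨hI, u, v, hne, rfl, f', hf', hspan⟩ := hf
  have huv := monomialDiff_mem_iff.1 hI
  -- Any monomial dividing a member of the fibre of `u` involves only columns of `A_f`; there is no
  -- cancellation because the entries are nonnegative.
  have hcol : ∀ w m : ι →₀ ℕ, multidegree A (m + w) = multidegree A u →
      ∀ j, w j ≠ 0 → j ∈ columnsIn A (dividingVars A u) := by
    intro w m hw j hj i
    refine ⟨hpos i j, fun hij => ?_⟩
    change 1 ≤ multidegree A u i
    rw [← hw, multidegree, Finsupp.sum]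
    have hmem : j ∈ (m + w).support := by
      simp only [Finsupp.mem_support_iff, Finsupp.add_apply]
      omega
    refine le_trans ?_ (Finset.single_le_sum (fun k _ => mul_nonneg (Int.natCast_nonneg _)
      (hpos i k)) hmem)
    have h1 : 0 < A i j := lt_of_le_of_ne (hpos i j) hij.symm
    have h2 : 0 < ((m + w) j : ℤ) := by
      simp only [Finsupp.add_apply]
      omega
    exact Int.add_one_le_iff.2 (mul_pos h2 h1)
  have hdvd : ∀ p q m m' : ι →₀ ℕ, multidegree A (m + p) = multidegree A u →
      multidegree A (m' + q) = multidegree A u → multidegree A p = multidegree A q →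
      ∃ h, monomialDiff K p q = h * monomialDiff K u v := by
    intro p q m m' hp hq hpq
    obtain ⟨p', rfl⟩ := exists_mapDomain_eq (hcol p m hp)
    obtain ⟨q', rfl⟩ := exists_mapDomain_eq (hcol q m' hq)
    have h1 : monomialDiff K p' q' ∈ Ideal.span {f'} := by
      rw [← hspan, monomialDiff_mem_iff, ← multidegree_mapDomain, ← multidegree_mapDomain, hpq]
    obtain ⟨h, hh⟩ := Ideal.mem_span_singleton'.1 h1
    exact ⟨rename Subtype.val h, by rw [← hf', ← map_mul, hh, rename_monomialDiff]⟩
  have hdeg : ∀ p q h, p ≠ q → p.degree = q.degree →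
      monomialDiff K p q = h * monomialDiff K u v → p.degree = h.totalDegree + u.degree := by
    intro p q h hpq hd he
    have h0 : h ≠ 0 := by
      rintro rfl
      rw [zero_mul] at he
      exact monomialDiff_ne_zero hpq he
    rw [← totalDegree_monomialDiff (K := K) hpq hd, he,
      totalDegree_mul_of_isDomain h0 (monomialDiff_ne_zero hne),
      totalDegree_monomialDiff hne (hA _ _ huv)]
  -- For a third monomial `w` of the fibre, `u - w` would be a multiple of `u - v` of the same
  -- degree, hence a scalar multiple, in which `w` does not occur.
  have hfib : ∀ w, multidegree A w = multidegree A u → w = u ∨ w = v := by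
    classical
    intro w hw
    by_contra! hcon
    obtain ⟨h, hh⟩ := hdvd u w 0 0 (by rw [zero_add]) (by rw [zero_add, hw]) hw.symm
    have h1 := hdeg u w h hcon.1.symm (hA _ _ hw.symm) hh
    have h2 : h.totalDegree = 0 := by omega
    rw [totalDegree_eq_zero_iff_eq_C] at h2
    rw [h2] at hh
    have h3 := congrArg (coeff w) hh
    rw [coeff_C_mul, coeff_monomialDiff, coeff_monomialDiff, if_neg hcon.1.symm, if_pos rfl,
      if_neg hcon.2.symm] at h3
    simp at h3
  refine ⟨⟨u, v, hne, rfl⟩, hI, fun F hF => ?_⟩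
  have hFI : F ⊆ toricIdeal K A := by
    rw [← hF.2]
    exact Ideal.subset_span
  have h1 := mem_span_of_multidegree hF.1 hFI huv (by rw [hF.2]; exact hI)
  have h2 : {g ∈ F | ∃ p q m : ι →₀ ℕ, p ≠ q ∧ g = monomialDiff K p q ∧
      multidegree A p = multidegree A q ∧
      multidegree A (m + p) = multidegree A u}.Nonempty := by
    by_contra h
    rw [Set.not_nonempty_iff_eq_empty] at h
    rw [h, Ideal.span_empty, Ideal.mem_bot] at h1
    exact monomialDiff_ne_zero hne h1
  obtain ⟨_, hgF, p, q, m, hpq, rfl, hd, hm⟩ := h2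
  have hm' : multidegree A (m + q) = multidegree A u := by
    rw [← hm, multidegree_add, multidegree_add, hd]
  obtain ⟨h, hh⟩ := hdvd p q m m hm hm' hd
  have h3 := hdeg p q h hpq (hA _ _ hd) hh
  have h4 : m.degree + p.degree = u.degree := by
    rw [← map_add]
    exact hA _ _ hm
  -- Divisibility by `u - v` gives `p.degree ≥ u.degree`, while `m + p` has degree `u.degree`.
  have h5 : m = 0 := by
    rw [← Finsupp.degree_eq_zero_iff]
    omega
  subst h5
  rw [zero_add] at hm hm'
  rcases hfib p hm with rfl | rfl <;> rcases hfib q hm' with rfl | rfl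
  · exact absurd rfl hpq
  · exact .inl hgF
  · right
    rwa [neg_monomialDiff]
  · exact absurd rfl hpq

end ToricAlgebra

/-! ### Alternating walks and their exponent vectors. -/

section AlternatingWalks

variable {V : Type*} {G : SimpleGraph V}

/-- The exponent vectors of the product of the edges at even positions, respectively at odd
positions, of a walk. -/
noncomputable def altExponents {x y : V} :
    G.Walk x y → (G.edgeSet →₀ ℕ) × (G.edgeSet →₀ ℕ)
  | .nil => 0
  | .cons (v := z) h p =>
    (Finsupp.single ⟨s(x, z), G.mem_edgeSet.2 h⟩ 1 + (altExponents p).2, (altExponents p).1)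

lemma altExponents_nil {x : V} : altExponents (.nil : G.Walk x x) = 0 := rfl

lemma altExponents_cons {x y z : V} (h : G.Adj x y) (p : G.Walk y z) :
    altExponents (.cons h p) =
      (Finsupp.single ⟨s(x, y), G.mem_edgeSet.2 h⟩ 1 + (altExponents p).2, (altExponents p).1) := rfl

lemma altExponents_append {x y z : V} (p : G.Walk x y) (q : G.Walk y z) :
    altExponents (p.append q) = altExponents p +
      (if Even p.length then altExponents q else (altExponents q).swap) := by
  induction p with
  | nil => simp [altExponents_nil]
  | cons h p ih =>
    rw [SimpleGraph.Walk.cons_append, altExponents_cons, altExponents_cons, ih]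
    by_cases hp : Even p.length <;>
      simp [hp, Prod.ext_iff, add_assoc, Nat.even_add_one]

/-- Reversal sends position `i` to `length - 1 - i`, which preserves the parity of positions exactly
when the length is odd. -/
lemma altExponents_reverse {x y : V} (p : G.Walk x y) :
    altExponents p.reverse =
      if Even p.length then (altExponents p).swap else altExponents p := by
  induction p with
  | nil => simp [altExponents_nil]
  | @cons x y z h p ih =>
    have hs : (⟨s(y, x), G.mem_edgeSet.2 h.symm⟩ : G.edgeSet) = ⟨s(x, y), G.mem_edgeSet.2 h⟩ := Subtype.ext Sym2.eq_swap
    rw [SimpleGraph.Walk.reverse_cons, altExponents_append, ih, SimpleGraph.Walk.length_reverse,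
      altExponents_cons, altExponents_cons, altExponents_nil, hs]
    by_cases hp : Even p.length <;>
      simp [hp, Prod.ext_iff, add_comm (Finsupp.single _ _), Nat.even_add_one]

lemma altExponents_degree {x y : V} (p : G.Walk x y) :
    (altExponents p).1.degree = (p.length + 1) / 2 ∧ (altExponents p).2.degree = p.length / 2 := by
  induction p with
  | nil => simp [altExponents_nil]
  | cons h p ih =>
    rw [altExponents_cons, map_add, Finsupp.degree_single, ih.1, ih.2,
      SimpleGraph.Walk.length_cons]
    omega

lemma mem_edges_iff_altExponents {x y : V} (p : G.Walk x y) (e : G.edgeSet) :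
    (e : Sym2 V) ∈ p.edges ↔ (altExponents p).1 e ≠ 0 ∨ (altExponents p).2 e ≠ 0 := by
  classical
  induction p with
  | nil => simp [altExponents_nil]
  | @cons x y z h p ih =>
    rw [altExponents_cons, SimpleGraph.Walk.edges_cons, List.mem_cons, ih]
    simp only [Finsupp.add_apply, Finsupp.single_apply, Subtype.ext_iff]
    by_cases he : (e : Sym2 V) = s(x, y)
    · simp [he]
    · simp [he, Ne.symm he, or_comm]

lemma graphMatrix_apply [DecidableEq V] (x : V) (e : G.edgeSet) :
    graphMatrix G x e = if x ∈ (e : Sym2 V) then 1 else 0 := by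
  classical
  simp [graphMatrix, SimpleGraph.incMatrix_apply', SimpleGraph.incidenceSet]

lemma graphMatrix_nonneg (x : V) (e : G.edgeSet) : 0 ≤ graphMatrix G x e := by
  classical
  rw [graphMatrix_apply]
  split_ifs <;> simp

lemma multidegree_nonneg (u : G.edgeSet →₀ ℕ) (x : V) : 0 ≤ multidegree (graphMatrix G) u x :=
  Finset.sum_nonneg fun e _ => mul_nonneg (Int.natCast_nonneg _) (graphMatrix_nonneg x e)

lemma multidegree_mono {u v : G.edgeSet →₀ ℕ} (h : u ≤ v) (x : V) :
    multidegree (graphMatrix G) u x ≤ multidegree (graphMatrix G) v x := by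
  obtain ⟨w, rfl⟩ := exists_add_of_le h
  rw [multidegree_add, Pi.add_apply]
  linarith [multidegree_nonneg w x]

lemma multidegree_single_edge [DecidableEq V] (e : G.edgeSet) (n : ℕ) (x : V) :
    multidegree (graphMatrix G) (Finsupp.single e n) x =
      if x ∈ (e : Sym2 V) then (n : ℤ) else 0 := by
  rw [multidegree_single, graphMatrix_apply]
  split_ifs <;> simp

lemma le_multidegree (u : G.edgeSet →₀ ℕ) {x : V} {e : G.edgeSet} (hx : x ∈ (e : Sym2 V)) :
    (u e : ℤ) ≤ multidegree (graphMatrix G) u x := by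
  classical
  have h := multidegree_mono (Finsupp.single_le_iff.2 (le_refl (u e))) x
  rwa [multidegree_single_edge, if_pos hx] at h

lemma add_le_multidegree (u : G.edgeSet →₀ ℕ) {x : V} {e e' : G.edgeSet} (hne : e ≠ e')
    (hx : x ∈ (e : Sym2 V)) (hx' : x ∈ (e' : Sym2 V)) :
    (u e : ℤ) + u e' ≤ multidegree (graphMatrix G) u x := by
  classical
  have hle : Finsupp.single e (u e) + Finsupp.single e' (u e') ≤ u := by
    intro j
    simp only [Finsupp.add_apply, Finsupp.single_apply]
    by_cases h1 : e = j
    · subst h1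
      simp [hne.symm]
    · by_cases h2 : e' = j
      · subst h2
        simp [h1]
      · simp [h1, h2]
  have h := multidegree_mono hle x
  rwa [multidegree_add, Pi.add_apply, multidegree_single_edge, multidegree_single_edge, if_pos hx,
    if_pos hx'] at h

lemma exists_edge_of_multidegree_pos {u : G.edgeSet →₀ ℕ} {x : V}
    (h : 0 < multidegree (graphMatrix G) u x) : ∃ e : G.edgeSet, u e ≠ 0 ∧ x ∈ (e : Sym2 V) := by
  classical
  by_contra! hcon
  refine h.ne' (Finset.sum_eq_zero fun e he => ?_)
  have h0 : graphMatrix G x e = 0 := by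
    rw [graphMatrix_apply, if_neg (hcon e (by simpa using he))]
  exact mul_eq_zero_of_right _ h0

lemma sum_multidegree [Fintype V] (u : G.edgeSet →₀ ℕ) :
    ∑ x, multidegree (graphMatrix G) u x = 2 * u.degree := by
  classical
  induction u using Finsupp.induction_linear with
  | zero => simp [multidegree_zero]
  | add u v hu hv =>
    simp only [multidegree_add, Pi.add_apply, Finset.sum_add_distrib, hu, hv, map_add]
    push_cast
    ring
  | single e n =>
    obtain ⟨e, he⟩ := e
    induction e using Sym2.ind with
    | _ x y =>
      have hxy : x ≠ y := SimpleGraph.Adj.ne he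
      simp only [multidegree_single_edge, Finsupp.degree_single, ← Finset.sum_filter]
      have : Finset.univ.filter (fun z => z ∈ s(x, y)) = {x, y} := by
        ext z
        simp
      rw [this, Finset.sum_pair hxy]
      ring

lemma degree_eq_of_multidegree_eq [Finite V] {u v : G.edgeSet →₀ ℕ}
    (h : multidegree (graphMatrix G) u = multidegree (graphMatrix G) v) :
    u.degree = v.degree := by
  have := Fintype.ofFinite V
  have h1 := sum_multidegree u
  rw [h, sum_multidegree v] at h1
  omega

/-- Consecutive edges have opposite signs, so the contributions of interior vertices telescope and
only the two ends survive. -/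
lemma multidegree_altExponents [DecidableEq V] {x y : V} (p : G.Walk x y) (z : V) :
    multidegree (graphMatrix G) (altExponents p).1 z -
      multidegree (graphMatrix G) (altExponents p).2 z =
    (if z = x then 1 else 0) - (-1) ^ p.length * (if z = y then 1 else 0) := by
  induction p with
  | nil => simp [altExponents_nil]
  | @cons x y w h p ih =>
    rw [altExponents_cons, multidegree_add, Pi.add_apply, multidegree_single_edge,
      SimpleGraph.Walk.length_cons, pow_succ]
    have hxy := h.ne
    have : (if z ∈ s(x, y) then ((1 : ℕ) : ℤ) else 0) =
        (if z = x then 1 else 0) + (if z = y then 1 else 0) := by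
      by_cases h1 : z = x
      · subst h1
        simp [hxy]
      · simp [h1]
    simp only [this]
    linarith

lemma multidegree_eq_of_even_closed {x : V} (p : G.Walk x x) (hp : Even p.length) :
    multidegree (graphMatrix G) (altExponents p).1 =
      multidegree (graphMatrix G) (altExponents p).2 := by
  classical
  funext z
  have := multidegree_altExponents p z
  rw [hp.neg_one_pow, one_mul, sub_self] at this
  linarith

/-- An odd closed walk can be cut at each of its other vertices to obtain shorter walks of both
parities. -/
lemma exists_alternating_subwalk {a y : V} (W : G.Walk a a) (hodd : Odd W.length)
    (hy : y ∈ W.support) (hya : y ≠ a) :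
    (∃ q : G.Walk a y, Even q.length ∧ q.length < W.length ∧ altExponents q ≤ altExponents W) ∧
    (∃ q : G.Walk a y, Odd q.length ∧ q.length < W.length ∧ altExponents q ≤ altExponents W) := by
  obtain ⟨q, r, rfl⟩ := SimpleGraph.Walk.mem_support_iff_exists_append.1 hy
  have hq : q.length ≠ 0 := fun h => hya (SimpleGraph.Walk.eq_of_length_eq_zero h).symm
  have hr : r.length ≠ 0 := fun h => hya (SimpleGraph.Walk.eq_of_length_eq_zero h)
  rw [SimpleGraph.Walk.length_append] at hodd ⊢
  have h1 : altExponents q ≤ altExponents (q.append r) := by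
    rw [altExponents_append]
    exact le_self_add
  -- As the total length is odd, `q` and `r` have opposite parities: for even `q` neither appending
  -- nor reversing swaps the exponents of `r`, and for odd `q` both do.
  have h2 : altExponents r.reverse ≤ altExponents (q.append r) := by
    rw [altExponents_append, altExponents_reverse]
    by_cases hqe : Even q.length
    · have : ¬ Even r.length := fun h => by
        rw [← Nat.not_even_iff_odd] at hodd
        exact hodd (hqe.add h)
      simp only [hqe, this, if_true, if_false]
      exact le_add_self
    · have : Even r.length := by
        rw [Nat.odd_add] at hodd
        exact hodd.1 (Nat.not_even_iff_odd.1 hqe)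
      simp only [hqe, this, if_true, if_false]
      exact le_add_self
  have h3 : r.reverse.length = r.length := SimpleGraph.Walk.length_reverse r
  rcases Nat.even_or_odd q.length with hqe | hqo
  · refine ⟨⟨q, hqe, by omega, h1⟩, ⟨r.reverse, ?_, by omega, h2⟩⟩
    rw [h3]
    rw [add_comm, Nat.odd_add] at hodd
    exact hodd.2 hqe
  · refine ⟨⟨r.reverse, ?_, by omega, h2⟩, ⟨q, hqo, by omega, h1⟩⟩
    rw [h3]
    rw [Nat.odd_add] at hodd
    exact hodd.1 hqo

/-- If the monomials `X ^ p` and `X ^ q` have the same degree at all vertices different from `a`,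
there is an alternating closed walk that visits `a` only at its ends. -/
lemma exists_alternating_closed_walk {p q : G.edgeSet →₀ ℕ} {a : V}
    (hpq : ∀ x, x ≠ a → multidegree (graphMatrix G) p x = multidegree (graphMatrix G) q x)
    (ha : 0 < multidegree (graphMatrix G) p a) :
    ∃ W : G.Walk a a, 0 < W.length ∧ (∀ i, 0 < i → i < W.length → W.getVert i ≠ a) ∧
      altExponents W ≤ (p, q) := by
  classical
  by_contra hcon
  have step : ∀ n, ∃ (y : V) (W : G.Walk a y), W.length = n + 1 ∧
      (∀ i, 0 < i → i ≤ W.length → W.getVert i ≠ a) ∧ altExponents W ≤ (p, q) := by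
    intro n
    induction n with
    | zero =>
      obtain ⟨⟨e, he⟩, hpe, hae⟩ := exists_edge_of_multidegree_pos ha
      obtain ⟨y, rfl⟩ := Sym2.mem_iff_exists.1 hae
      have he' : G.Adj a y := he
      refine ⟨y, .cons he' .nil, by simp, ?_, ?_⟩
      · intro i hi hi'
        simp only [SimpleGraph.Walk.length_cons, SimpleGraph.Walk.length_nil, zero_add] at hi'
        obtain rfl : i = 1 := by omega
        simpa using he'.ne.symm
      · rw [altExponents_cons, altExponents_nil]
        refine ⟨?_, by simp⟩
        simp only [Prod.snd_zero, add_zero, Finsupp.single_le_iff]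
        omega
    | succ n ih =>
      obtain ⟨y, W, hlen, hret, hle⟩ := ih
      have hya : y ≠ a := by
        have := hret W.length (by omega) le_rfl
        rwa [SimpleGraph.Walk.getVert_length] at this
      have hformula := multidegree_altExponents W y
      rw [if_neg hya, if_pos rfl, zero_sub, mul_one] at hformula
      obtain ⟨p', hp'⟩ := exists_add_of_le hle.1
      obtain ⟨q', hq'⟩ := exists_add_of_le hle.2
      simp only at hp' hq'
      have hbal := hpq y hya
      rw [hp', hq', multidegree_add, multidegree_add, Pi.add_apply, Pi.add_apply] at hbal
      -- The walk is unbalanced at its end `y` but `(p, q)` is balanced there, so the unused part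
      -- has an edge at `y` on the side that the parity of the next step requires.
      have hext : ∃ (z : V) (h : G.Adj y z), altExponents (W.append (.cons h .nil)) ≤ (p, q) := by
        rcases Nat.even_or_odd W.length with hW | hW
        · rw [hW.neg_one_pow] at hformula
          have hpos : 0 < multidegree (graphMatrix G) p' y := by
            linarith [multidegree_nonneg q' y]
          obtain ⟨⟨e, he⟩, hpe, hye⟩ := exists_edge_of_multidegree_pos hpos
          obtain ⟨z, rfl⟩ := Sym2.mem_iff_exists.1 hye
          refine ⟨z, G.mem_edgeSet.1 he, ?_⟩
          rw [altExponents_append, if_pos hW, altExponents_cons, altExponents_nil]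
          refine ⟨?_, by simpa using hle.2⟩
          simp only [Prod.snd_zero, add_zero, Prod.fst_add]
          rw [hp']
          gcongr
          rw [Finsupp.single_le_iff]
          exact Nat.one_le_iff_ne_zero.2 hpe
        · rw [hW.neg_one_pow] at hformula
          have hpos : 0 < multidegree (graphMatrix G) q' y := by
            linarith [multidegree_nonneg p' y]
          obtain ⟨⟨e, he⟩, hpe, hye⟩ := exists_edge_of_multidegree_pos hpos
          obtain ⟨z, rfl⟩ := Sym2.mem_iff_exists.1 hye
          refine ⟨z, G.mem_edgeSet.1 he, ?_⟩
          rw [altExponents_append, if_neg (Nat.not_even_iff_odd.2 hW), altExponents_cons,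
            altExponents_nil]
          refine ⟨by simpa using hle.1, ?_⟩
          simp only [Prod.snd_zero, add_zero, Prod.snd_add, Prod.snd_swap]
          rw [hq']
          gcongr
          rw [Finsupp.single_le_iff]
          exact Nat.one_le_iff_ne_zero.2 hpe
      obtain ⟨z, h, hz⟩ := hext
      have hlen' : (W.append (.cons h .nil)).length = W.length + 1 := by simp
      have hget : ∀ i, i ≤ W.length → (W.append (.cons h .nil)).getVert i = W.getVert i := by
        intro i hi
        rw [SimpleGraph.Walk.getVert_append]
        split_ifs with hlt
        · rfl
        · obtain rfl : i = W.length := by omega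
          simp
      by_cases hza : z = a
      · subst hza
        exfalso
        refine hcon ⟨_, by omega, fun i hi hi' => ?_, hz⟩
        rw [hget i (by omega)]
        exact hret i hi (by omega)
      · refine ⟨z, _, by rw [hlen', hlen], fun i hi hi' => ?_, hz⟩
        rcases Nat.lt_or_ge W.length i with hlt | hge
        · obtain rfl : i = (W.append (.cons h .nil)).length := by omega
          rwa [SimpleGraph.Walk.getVert_length]
        · rw [hget i hge]
          exact hret i hi hge
  -- A walk that never returns can always be extended, so it eventually uses more edges than `(p,
  -- q)` provides.
  obtain ⟨y, W, hlen, -, hle⟩ := step (p.degree + q.degree)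
  have h1 := altExponents_degree W
  have h2 := Finsupp.degree_mono hle.1
  have h3 := Finsupp.degree_mono hle.2
  simp only at h2 h3
  omega

end AlternatingWalks

/-! ### Structure of unlinked pairs. -/

section Unlinked

variable {V : Type*} {G : SimpleGraph V}

/-- Two exponent vectors of the same multidegree are unlinked if no exponent vector of this
multidegree meets the supports of both. -/
def Unlinked (u v : G.edgeSet →₀ ℕ) : Prop :=
  multidegree (graphMatrix G) u = multidegree (graphMatrix G) v ∧
    ∀ w, multidegree (graphMatrix G) w = multidegree (graphMatrix G) u →
      ∀ e e', u e ≠ 0 → w e ≠ 0 → v e' ≠ 0 → w e' = 0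

lemma Unlinked.eq_zero_or_eq_zero {u v : G.edgeSet →₀ ℕ} (h : Unlinked u v) (e : G.edgeSet) :
    u e = 0 ∨ v e = 0 := by
  by_contra! hcon
  exact hcon.1 (h.2 u rfl e e hcon.1 hcon.1 hcon.2)

lemma exists_apply_ne_zero {ι : Type*} {u : ι →₀ ℕ} (h : u ≠ 0) : ∃ e, u e ≠ 0 := by
  by_contra! hcon
  exact h (Finsupp.ext hcon)

/-- Exchanging `u₁` for `v₁` inside `u` gives a member of the fibre that meets `v` in `v₁` and `u`
in the remainder `u - u₁`; hence the remainder is zero, and comparing degrees gives `v₁ = v`. -/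
lemma Unlinked.eq_of_le [Finite V] {u v u₁ v₁ : G.edgeSet →₀ ℕ} (h : Unlinked u v)
    (hu : u₁ ≤ u) (hv : v₁ ≤ v)
    (hd : multidegree (graphMatrix G) u₁ = multidegree (graphMatrix G) v₁) (h0 : v₁ ≠ 0) :
    u₁ = u ∧ v₁ = v := by
  have huv := degree_eq_of_multidegree_eq h.1
  have huv₁ := degree_eq_of_multidegree_eq hd
  obtain ⟨u₂, rfl⟩ := exists_add_of_le hu
  obtain ⟨v₂, rfl⟩ := exists_add_of_le hv
  obtain ⟨e', he'⟩ := exists_apply_ne_zero h0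
  have hu₂ : u₂ = 0 := by
    by_contra hne
    obtain ⟨e, he⟩ := exists_apply_ne_zero hne
    have := h.2 (u₂ + v₁) (by rw [multidegree_add, multidegree_add, hd, add_comm]) e e'
      (by simp [he]) (by simp [he]) (by simp [he'])
    simp [he'] at this
  subst hu₂
  have hv₂ : v₂ = 0 := by
    rw [← Finsupp.degree_eq_zero_iff]
    rw [map_add, map_add, map_zero] at huv
    omega
  subst hv₂
  simp

lemma altExponents_fst_ne_zero {x y : V} {W : G.Walk x y} (h : 0 < W.length) :
    (altExponents W).1 ≠ 0 := by
  rw [Ne, ← Finsupp.degree_eq_zero_iff, (altExponents_degree W).1]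
  omega

lemma altExponents_snd_ne_zero {x y : V} {W : G.Walk x y} (h : 1 < W.length) :
    (altExponents W).2 ≠ 0 := by
  rw [Ne, ← Finsupp.degree_eq_zero_iff, (altExponents_degree W).2]
  omega

lemma multidegree_altExponents_le_one {a x y : V} (W : G.Walk x y)
    (h : ∀ i, i < W.length → W.getVert i ≠ a) :
    multidegree (graphMatrix G) (altExponents W).1 a +
      multidegree (graphMatrix G) (altExponents W).2 a ≤ 1 := by
  classical
  induction W with
  | nil => simp [altExponents_nil, multidegree_zero]
  | @cons x y z hadj p ih =>
    rw [altExponents_cons, multidegree_add, Pi.add_apply, multidegree_single_edge]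
    have hx : x ≠ a := by simpa using h 0 (by simp)
    by_cases hy : y = a
    · have hp : p.length = 0 := by
        by_contra hp
        have := h 1 (by rw [SimpleGraph.Walk.length_cons]; omega)
        simp [hy] at this
      have hd := altExponents_degree p
      rw [hp] at hd
      have h1 : (altExponents p).1 = 0 := by
        rw [← Finsupp.degree_eq_zero_iff]
        omega
      have h2 : (altExponents p).2 = 0 := by
        rw [← Finsupp.degree_eq_zero_iff]
        omega
      simp [h1, h2, multidegree_zero, hy]
    · have := ih fun i hi => by
        have := h (i + 1) (by rw [SimpleGraph.Walk.length_cons]; omega)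
        simpa using this
      rw [if_neg (by simp [hx.symm, Ne.symm hy])]
      linarith

/-- Only the first and last edges contain `a`, and in an even closed walk they lie on opposite
sides. -/
lemma multidegree_le_one_of_even {a : V} {W : G.Walk a a} (hW : Even W.length)
    (hret : ∀ i, 0 < i → i < W.length → W.getVert i ≠ a) :
    multidegree (graphMatrix G) (altExponents W).1 a ≤ 1 := by
  classical
  have heq := congrFun (multidegree_eq_of_even_closed W hW) a
  cases W with
  | nil => simp [altExponents_nil, multidegree_zero]
  | @cons _ y _ hadj p =>
    have h1 := multidegree_altExponents_le_one (a := a) p fun i hi => by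
      simpa using hret (i + 1) (by omega) (by rw [SimpleGraph.Walk.length_cons]; omega)
    rw [altExponents_cons, multidegree_add, Pi.add_apply, multidegree_single_edge] at heq ⊢
    rw [if_pos (by simp)] at heq ⊢
    push_cast at heq ⊢
    linarith

/-- At a vertex of degree at least two, an unlinked pair decomposes into two odd closed walks. -/
lemma Unlinked.exists_odd_closed_walks [Finite V] {u v : G.edgeSet →₀ ℕ} (h : Unlinked u v) {a : V}
    (ha : 2 ≤ multidegree (graphMatrix G) u a) :
    ∃ W₁ W₂ : G.Walk a a, Odd W₁.length ∧ Odd W₂.length ∧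
      (∀ i, 0 < i → i < W₁.length → W₁.getVert i ≠ a) ∧
      (∀ i, 0 < i → i < W₂.length → W₂.getVert i ≠ a) ∧
      u = (altExponents W₁).1 + (altExponents W₂).2 ∧
      v = (altExponents W₁).2 + (altExponents W₂).1 := by
  classical
  obtain ⟨W₁, hpos₁, hret₁, hle₁⟩ := exists_alternating_closed_walk (q := v) (a := a)
    (fun x _ => congrFun h.1 x) (by linarith)
  -- An even walk is balanced, hence would be the whole pair, whose degree at `a` would then be at
  -- most one.
  have hodd₁ : Odd W₁.length := by
    by_contra hev
    rw [Nat.not_odd_iff_even] at hev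
    have h1 : 1 < W₁.length := by
      obtain ⟨k, hk⟩ := hev
      omega
    have h2 := (h.eq_of_le hle₁.1 hle₁.2 (multidegree_eq_of_even_closed W₁ hev)
      (altExponents_snd_ne_zero h1)).1
    have h3 := multidegree_le_one_of_even hev hret₁
    rw [h2] at h3
    linarith
  obtain ⟨u₂, hu₂⟩ := exists_add_of_le hle₁.1
  obtain ⟨v₂, hv₂⟩ := exists_add_of_le hle₁.2
  simp only at hu₂ hv₂
  -- Removing the odd walk `W₁` leaves an excess of two at `a` on the side of `v`, so the second
  -- walk starts with an edge of `v₂`.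
  have hbal : ∀ x, multidegree (graphMatrix G) v₂ x =
      multidegree (graphMatrix G) u₂ x + if x = a then 2 else 0 := by
    intro x
    have h1 := congrFun h.1 x
    rw [hu₂, hv₂, multidegree_add, multidegree_add, Pi.add_apply, Pi.add_apply] at h1
    have h2 := multidegree_altExponents W₁ x
    rw [hodd₁.neg_one_pow] at h2
    split_ifs at h2 ⊢ <;> linarith
  obtain ⟨W₂, hpos₂, hret₂, hle₂⟩ := exists_alternating_closed_walk (p := v₂) (q := u₂) (a := a)
    (fun x hx => by rw [hbal, if_neg hx, add_zero])
    (by rw [hbal, if_pos rfl]; linarith [multidegree_nonneg u₂ a])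
  have hu₂' : u₂ ≤ u := hu₂ ▸ le_add_self
  have hv₂' : v₂ ≤ v := hv₂ ▸ le_add_self
  have hodd₂ : Odd W₂.length := by
    by_contra hev
    rw [Nat.not_odd_iff_even] at hev
    have h2 := (h.eq_of_le (hle₂.2.trans hu₂') (hle₂.1.trans hv₂')
      (multidegree_eq_of_even_closed W₂ hev).symm (altExponents_fst_ne_zero hpos₂)).1
    have h3 := Finsupp.degree_mono hle₂.2
    rw [h2, hu₂, map_add] at h3
    have h4 := altExponents_fst_ne_zero hpos₁
    rw [Ne, ← Finsupp.degree_eq_zero_iff] at h4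
    simp only at h3
    omega
  refine ⟨W₁, W₂, hodd₁, hodd₂, hret₁, hret₂, ?_⟩
  have hmd : multidegree (graphMatrix G) ((altExponents W₁).1 + (altExponents W₂).2) =
      multidegree (graphMatrix G) ((altExponents W₁).2 + (altExponents W₂).1) := by
    funext x
    have h1 := multidegree_altExponents W₁ x
    have h2 := multidegree_altExponents W₂ x
    rw [hodd₁.neg_one_pow] at h1
    rw [hodd₂.neg_one_pow] at h2
    rw [multidegree_add, multidegree_add, Pi.add_apply, Pi.add_apply]
    linarith
  obtain ⟨h1, h2⟩ := h.eq_of_le (hu₂ ▸ add_le_add le_rfl hle₂.2)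
    (hv₂ ▸ add_le_add le_rfl hle₂.1) hmd (by
      intro h0
      rw [add_eq_zero] at h0
      exact altExponents_fst_ne_zero hpos₂ h0.2)
  exact ⟨h1.symm, h2.symm⟩

/-- At another common vertex, even pieces of both walks from `a` to it would form a proper balanced
subpair, contradicting `Unlinked.eq_of_le`. -/
lemma Unlinked.eq_of_mem_support [Finite V] {u v : G.edgeSet →₀ ℕ} (h : Unlinked u v) {a : V}
    {W₁ W₂ : G.Walk a a} (hodd₁ : Odd W₁.length) (hodd₂ : Odd W₂.length)
    (hu : u = (altExponents W₁).1 + (altExponents W₂).2)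
    (hv : v = (altExponents W₁).2 + (altExponents W₂).1) {y : V}
    (hy₁ : y ∈ W₁.support) (hy₂ : y ∈ W₂.support) : y = a := by
  classical
  by_contra hya
  obtain ⟨⟨q, hq, hql, hqle⟩, -⟩ := exists_alternating_subwalk W₁ hodd₁ hy₁ hya
  obtain ⟨⟨r, hr, hrl, hrle⟩, -⟩ := exists_alternating_subwalk W₂ hodd₂ hy₂ hya
  have hmd : multidegree (graphMatrix G) ((altExponents q).1 + (altExponents r).2) =
      multidegree (graphMatrix G) ((altExponents q).2 + (altExponents r).1) := by
    funext x
    have h1 := multidegree_altExponents q x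
    have h2 := multidegree_altExponents r x
    rw [hq.neg_one_pow] at h1
    rw [hr.neg_one_pow] at h2
    rw [multidegree_add, multidegree_add, Pi.add_apply, Pi.add_apply]
    linarith
  have hrpos : 0 < r.length := by
    by_contra h0
    exact hya (SimpleGraph.Walk.eq_of_length_eq_zero (p := r) (by omega)).symm
  have h1 := (h.eq_of_le (hu ▸ add_le_add hqle.1 hrle.2) (hv ▸ add_le_add hqle.2 hrle.1) hmd (by
      intro h0
      rw [add_eq_zero] at h0
      exact altExponents_fst_ne_zero hrpos h0.2)).1
  have h2 := congrArg Finsupp.degree (h1.trans hu)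
  rw [map_add, map_add, (altExponents_degree _).1, (altExponents_degree _).1,
    (altExponents_degree _).2, (altExponents_degree _).2] at h2
  obtain ⟨k, hk⟩ := hq
  obtain ⟨l, hl⟩ := hr
  obtain ⟨m, hm⟩ := hodd₁
  obtain ⟨n, hn⟩ := hodd₂
  omega

/-- An edge joining the two walks away from `a` allows a rerouting of `v` that links `u` and `v`.
The piece `q` towards `y` is even and the piece `r` towards `z` is odd, so that the imbalances at
`y` and `z` are repaired by that single edge. -/
lemma Unlinked.eq_of_adj [Finite V] {u v : G.edgeSet →₀ ℕ} (h : Unlinked u v) {a : V}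
    {W₁ W₂ : G.Walk a a} (hodd₁ : Odd W₁.length) (hodd₂ : Odd W₂.length)
    (hu : u = (altExponents W₁).1 + (altExponents W₂).2)
    (hv : v = (altExponents W₁).2 + (altExponents W₂).1) {y z : V}
    (hy : y ∈ W₁.support) (hz : z ∈ W₂.support) (hyz : G.Adj y z) : y = a ∨ z = a := by
  classical
  by_contra! hcon
  obtain ⟨hya, hza⟩ := hcon
  obtain ⟨⟨q, hq, hql, hqle⟩, -⟩ := exists_alternating_subwalk W₁ hodd₁ hy hya
  obtain ⟨-, ⟨r, hr, hrl, hrle⟩⟩ := exists_alternating_subwalk W₂ hodd₂ hz hza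
  have hvle : (altExponents q).2 + (altExponents r).1 ≤ v := hv ▸ add_le_add hqle.2 hrle.1
  obtain ⟨v₂, hv₂⟩ := exists_add_of_le hvle
  have hv₂0 : v₂ ≠ 0 := by
    rintro rfl
    have h2 := congrArg Finsupp.degree (hv₂.symm.trans hv)
    rw [add_zero, map_add, map_add, (altExponents_degree _).1, (altExponents_degree _).1,
      (altExponents_degree _).2, (altExponents_degree _).2] at h2
    obtain ⟨k, hk⟩ := hq
    obtain ⟨l, hl⟩ := hr
    obtain ⟨m, hm⟩ := hodd₁
    obtain ⟨n, hn⟩ := hodd₂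
    omega
  have hqpos : 0 < q.length := by
    by_contra h0
    exact hya (SimpleGraph.Walk.eq_of_length_eq_zero (p := q) (by omega)).symm
  obtain ⟨e, he⟩ := exists_apply_ne_zero (altExponents_fst_ne_zero hqpos)
  obtain ⟨e', he'⟩ := exists_apply_ne_zero hv₂0
  -- The linking monomial: in `v`, the edges `q.2 + r.1` are exchanged for `q.1 + r.2` and the edge
  -- `yz`. It meets `u` in `q.1` and `v` in the leftover `v₂`.
  have hw := h.2 (v₂ + ((altExponents q).1 + ((altExponents r).2 +
      Finsupp.single ⟨s(y, z), G.mem_edgeSet.2 hyz⟩ 1))) (by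
    funext x
    rw [h.1, hv₂]
    simp only [multidegree_add, Pi.add_apply, multidegree_single_edge]
    have h1 := multidegree_altExponents q x
    have h2 := multidegree_altExponents r x
    rw [hq.neg_one_pow] at h1
    rw [hr.neg_one_pow] at h2
    have : (if x ∈ s(y, z) then ((1 : ℕ) : ℤ) else 0) =
        (if x = y then 1 else 0) + (if x = z then 1 else 0) := by
      by_cases h1 : x = y
      · subst h1
        simp [hyz.ne]
      · simp [h1]
    rw [this]
    linarith) e e'
    (by rw [hu, Finsupp.add_apply]; have := hqle.1 e; omega)
    (by simp only [Finsupp.add_apply]; omega)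
    (by rw [hv₂, Finsupp.add_apply]; omega)
  simp only [Finsupp.add_apply] at hw
  omega

lemma Unlinked.mem_support_iff {u v : G.edgeSet →₀ ℕ} (h : Unlinked u v) {a : V}
    {W₁ W₂ : G.Walk a a} (hodd₁ : Odd W₁.length) (hodd₂ : Odd W₂.length)
    (hu : u = (altExponents W₁).1 + (altExponents W₂).2)
    (hv : v = (altExponents W₁).2 + (altExponents W₂).1) (x : V) :
    x ∈ W₁.support ∨ x ∈ W₂.support ↔ 0 < multidegree (graphMatrix G) u x := by
  have key : ∀ e : G.edgeSet, (e : Sym2 V) ∈ W₁.edges ∨ (e : Sym2 V) ∈ W₂.edges →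
      u e ≠ 0 ∨ v e ≠ 0 := by
    intro e he
    rw [mem_edges_iff_altExponents, mem_edges_iff_altExponents] at he
    rw [hu, hv]
    simp only [Finsupp.add_apply]
    omega
  have key' : ∀ e : G.edgeSet, x ∈ (e : Sym2 V) → u e ≠ 0 ∨ v e ≠ 0 →
      0 < multidegree (graphMatrix G) u x := by
    rintro e hx (he | he)
    · have := le_multidegree u hx
      omega
    · have := le_multidegree v hx
      rw [h.1]
      omega
  have hnil : ∀ {W : G.Walk a a}, Odd W.length → ¬ W.Nil := by
    intro W hW hn
    rw [← SimpleGraph.Walk.length_eq_zero_iff] at hn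
    rw [hn] at hW
    simp at hW
  constructor
  · rintro (hx | hx)
    · obtain ⟨e, he, hxe⟩ := (SimpleGraph.Walk.mem_support_iff_exists_mem_edges_of_not_nil
        (hnil hodd₁)).1 hx
      exact key' ⟨e, W₁.edges_subset_edgeSet he⟩ hxe (key _ (.inl he))
    · obtain ⟨e, he, hxe⟩ := (SimpleGraph.Walk.mem_support_iff_exists_mem_edges_of_not_nil
        (hnil hodd₂)).1 hx
      exact key' ⟨e, W₂.edges_subset_edgeSet he⟩ hxe (key _ (.inr he))
  · intro hx
    obtain ⟨e, he, hxe⟩ := exists_edge_of_multidegree_pos hx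
    rw [hu, Finsupp.add_apply] at he
    by_cases h1 : (altExponents W₁).1 e = 0
    · exact .inr (SimpleGraph.Walk.mem_support_of_mem_edges
        ((mem_edges_iff_altExponents W₂ e).2 (.inr (by omega))) hxe)
    · exact .inl (SimpleGraph.Walk.mem_support_of_mem_edges
        ((mem_edges_iff_altExponents W₁ e).2 (.inl h1)) hxe)

/-- At a vertex `a` of degree at least two, the graph on the vertices occurring in an unlinked pair
is separated by `a`; one of the parts contains a given vertex `b`, and the other one contains an
odd closed walk. -/
lemma Unlinked.exists_separation [Finite V] {u v : G.edgeSet →₀ ℕ} (h : Unlinked u v) {a b : V}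
    (ha : 2 ≤ multidegree (graphMatrix G) u a) (hb : 0 < multidegree (graphMatrix G) u b)
    (hab : b ≠ a) :
    ∃ W W' : G.Walk a a, Odd W.length ∧ b ∉ W.support ∧ b ∈ W'.support ∧
      (∀ x ∈ W.support, 0 < multidegree (graphMatrix G) u x) ∧
      (∀ x ∈ W'.support, 0 < multidegree (graphMatrix G) u x) ∧
      ∀ x ∈ W.support, x ≠ a → ∀ y, 0 < multidegree (graphMatrix G) u y → G.Adj x y →
        y ∈ W.support := by
  obtain ⟨W₁, W₂, hodd₁, hodd₂, -, -, hu, hv⟩ := h.exists_odd_closed_walks ha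
  have hS := h.mem_support_iff hodd₁ hodd₂ hu hv
  have hmeet : b ∈ W₁.support → b ∉ W₂.support := fun h₁ h₂ =>
    hab (h.eq_of_mem_support hodd₁ hodd₂ hu hv h₁ h₂)
  rcases (hS b).2 hb with hb₁ | hb₂
  · refine ⟨W₂, W₁, hodd₂, hmeet hb₁, hb₁, fun x hx => (hS x).1 (.inr hx),
      fun x hx => (hS x).1 (.inl hx), fun x hx hxa y hy hxy => ?_⟩
    rcases (hS y).2 hy with hy | hy
    · rcases h.eq_of_adj hodd₁ hodd₂ hu hv hy hx hxy.symm with rfl | rfl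
      · exact W₂.start_mem_support
      · exact absurd rfl hxa
    · exact hy
  · refine ⟨W₁, W₂, hodd₁, fun hb₁ => hmeet hb₁ hb₂, hb₂, fun x hx => (hS x).1 (.inl hx),
      fun x hx => (hS x).1 (.inr hx), fun x hx hxa y hy hxy => ?_⟩
    rcases (hS y).2 hy with hy | hy
    · exact hy
    · rcases h.eq_of_adj hodd₁ hodd₂ hu hv hx hy hxy with rfl | rfl
      · exact absurd rfl hxa
      · exact W₁.start_mem_support

lemma mulVec_apply_eq_sum [Fintype G.edgeSet] (z : G.edgeSet → ℤ) (x : V)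
    (s : Finset G.edgeSet) (hs : ∀ e ∈ s, x ∈ (e : Sym2 V))
    (hz : ∀ e : G.edgeSet, x ∈ (e : Sym2 V) → z e ≠ 0 → e ∈ s) :
    (graphMatrix G).mulVec z x = ∑ e ∈ s, z e := by
  classical
  rw [Matrix.mulVec, dotProduct]
  simp only [graphMatrix_apply, ite_mul, one_mul, zero_mul]
  rw [← Finset.sum_subset (Finset.subset_univ s)]
  · exact Finset.sum_congr rfl fun e he => if_pos (hs e he)
  · intro e _ he
    split_ifs with hx
    · by_contra h0
      exact he (hz e hx h0)
    · rfl

lemma multidegree_eq_mulVec [Fintype G.edgeSet] (u : G.edgeSet →₀ ℕ) :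
    multidegree (graphMatrix G) u = (graphMatrix G).mulVec fun e => (u e : ℤ) := by
  funext x
  rw [multidegree, Finsupp.sum_fintype _ _ (by simp), Matrix.mulVec, dotProduct]
  exact Finset.sum_congr rfl fun e _ => mul_comm _ _

/-- The local relation at each interior vertex flips the sign of `d` from one edge to the next, so
`d` is constant up to the alternating sign. The induction exchanges the roles of `u` and `v` at
every step. -/
lemma altExponents_values {a : V} {d : G.edgeSet → ℤ} {x y : V} (W : G.Walk x y)
    {u v : G.edgeSet →₀ ℕ}
    (hd : ∀ z, z ≠ a → ∀ e e' : G.edgeSet, z ∈ (e : Sym2 V) → z ∈ (e' : Sym2 V) → u e ≠ 0 →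
      v e' ≠ 0 → d e + d e' = 0)
    (hle : altExponents W ≤ (u, v)) (hret : ∀ i, 0 < i → i < W.length → W.getVert i ≠ a) :
    ∃ c, (∀ e, (altExponents W).1 e ≠ 0 → d e = c) ∧
      ∀ e, (altExponents W).2 e ≠ 0 → d e = -c := by
  classical
  induction W generalizing u v with
  | nil => exact ⟨0, by simp [altExponents_nil], by simp [altExponents_nil]⟩
  | @cons x y z h p ih =>
    rw [altExponents_cons] at hle
    obtain ⟨c, hc₁, hc₂⟩ := ih (u := v) (v := u)
      (fun z hz e e' he he' hv hu => by rw [add_comm]; exact hd z hz e' e he' he hu hv)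
      ⟨hle.2, le_trans le_add_self hle.1⟩
      (fun i hi hi' => by
        simpa using hret (i + 1) (by omega) (by rw [SimpleGraph.Walk.length_cons]; omega))
    refine ⟨d ⟨s(x, y), G.mem_edgeSet.2 h⟩, ?_⟩
    rw [altExponents_cons]
    cases p with
    | nil => simp [altExponents_nil, Finsupp.single_apply]
    | @cons _ w _ h' p' =>
      have h1 : (altExponents (.cons h' p')).1 ⟨s(y, w), G.mem_edgeSet.2 h'⟩ ≠ 0 := by
        simp [altExponents_cons]
      have h2 : y ≠ a := by
        simpa using hret 1 (by omega) (by simp)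
      have h3 := hd y h2 ⟨s(x, y), G.mem_edgeSet.2 h⟩ ⟨s(y, w), G.mem_edgeSet.2 h'⟩ (by simp)
        (by simp) (by
          have := hle.1 ⟨s(x, y), G.mem_edgeSet.2 h⟩
          simp only [Finsupp.add_apply, Finsupp.single_eq_same] at this
          omega) (by
          have := hle.2 ⟨s(y, w), G.mem_edgeSet.2 h'⟩
          simp only at this
          omega)
      have h4 := hc₁ _ h1
      refine ⟨fun e he => ?_, fun e he => ?_⟩
      · by_cases hee : e = ⟨s(x, y), G.mem_edgeSet.2 h⟩
        · rw [hee]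
        · rw [Finsupp.add_apply, Finsupp.single_eq_of_ne hee, zero_add] at he
          rw [hc₂ e he]
          linarith
      · rw [hc₁ e he]
        linarith

/-- An unlinked pair with at most one vertex of degree at least two is a squarefree circuit. -/
lemma Unlinked.mem_squarefreeCircuits [Finite V] (K : Type*) [Field K] {u v : G.edgeSet →₀ ℕ}
    (h : Unlinked u v) (hne : u ≠ v)
    (hdeg : ∀ a b, 2 ≤ multidegree (graphMatrix G) u a → 2 ≤ multidegree (graphMatrix G) u b →
      a = b) :
    monomialDiff K u v ∈ squarefreeCircuits K (graphMatrix G) := by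
  classical
  have := Fintype.ofFinite G.edgeSet
  -- An edge with exponent at least two would give both of its ends degree at least two.
  have hsq : ∀ w : G.edgeSet →₀ ℕ,
      multidegree (graphMatrix G) w = multidegree (graphMatrix G) u → ∀ e, w e ≤ 1 := by
    rintro w hw ⟨e, he⟩
    induction e using Sym2.ind with
    | _ x y =>
      by_contra! h2
      have hx := le_multidegree w (x := x) (e := ⟨s(x, y), he⟩) (by simp)
      have hy := le_multidegree w (x := y) (e := ⟨s(x, y), he⟩) (by simp)
      rw [hw] at hx hy
      exact (G.mem_edgeSet.1 he).ne (hdeg x y (by omega) (by omega))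
  have hu1 := hsq u rfl
  have hv1 := hsq v h.1.symm
  have hzero := h.eq_zero_or_eq_zero
  refine ⟨isCircuit_monomialDiff (T := {e | u e ≠ 0 ∨ v e ≠ 0}) hne (fun e he => .inl he)
    (fun e he => .inr he) hzero h.1 ?_, u, v, rfl, hu1, hv1⟩
  intro p q hp hq hpq
  set d : G.edgeSet → ℤ := fun e => (p e : ℤ) - q e with hd
  have hdT : ∀ e, d e ≠ 0 → u e ≠ 0 ∨ v e ≠ 0 := by
    intro e he
    by_contra hcon
    have h1 : p e = 0 := by
      by_contra h0
      exact hcon (hp e h0)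
    have h2 : q e = 0 := by
      by_contra h0
      exact hcon (hq e h0)
    simp [hd, h1, h2] at he
  have hker : (graphMatrix G).mulVec d = 0 := by
    have : d = (fun e => (p e : ℤ)) - fun e => (q e : ℤ) := rfl
    rw [this, Matrix.mulVec_sub, ← multidegree_eq_mulVec, ← multidegree_eq_mulVec, hpq, sub_self]
  -- At a vertex of degree at most one, `e` and `e'` are the only edges of the support, so the
  -- kernel equation there has just two terms.
  have hlocal : ∀ x, multidegree (graphMatrix G) u x ≤ 1 → ∀ e e' : G.edgeSet,
      x ∈ (e : Sym2 V) → x ∈ (e' : Sym2 V) → u e ≠ 0 → v e' ≠ 0 → d e + d e' = 0 := by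
    intro x hx e e' he he' hue hve
    have hee : e ≠ e' := by
      rintro rfl
      have := hzero e
      omega
    rw [← Finset.sum_pair hee, ← mulVec_apply_eq_sum d x {e, e'}, hker]
    · rfl
    · simp [he, he']
    · intro f hf hdf
      by_contra hcon
      simp only [Finset.mem_insert, Finset.mem_singleton, not_or] at hcon
      rcases hdT f hdf with h1 | h1
      · have := add_le_multidegree u hcon.1 hf he
        omega
      · have := add_le_multidegree v hcon.2 hf he'
        rw [← h.1] at this
        omega
  by_cases hbig : ∃ a, 2 ≤ multidegree (graphMatrix G) u a
  · obtain ⟨a, ha⟩ := hbig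
    obtain ⟨W₁, W₂, hodd₁, hodd₂, hret₁, hret₂, hu, hv⟩ := h.exists_odd_closed_walks ha
    have hsmall : ∀ x, x ≠ a → multidegree (graphMatrix G) u x ≤ 1 := by
      intro x hx
      by_contra! h2
      exact hx (hdeg x a (by omega) ha)
    obtain ⟨c₁, hc₁, hc₁'⟩ := altExponents_values W₁ (u := u) (v := v)
      (fun x hx => hlocal x (hsmall x hx)) ⟨hu ▸ le_self_add, hv ▸ le_self_add⟩ hret₁
    obtain ⟨c₂, hc₂, hc₂'⟩ := altExponents_values W₂ (u := v) (v := u)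
      (fun x hx e e' he he' hve hue => by
        rw [add_comm]
        exact hlocal x (hsmall x hx) e' e he' he hue hve)
      ⟨hv ▸ le_add_self, hu ▸ le_add_self⟩ hret₂
    have hde : ∀ e, d e = c₁ * ((altExponents W₁).1 e - (altExponents W₁).2 e) +
        c₂ * ((altExponents W₂).1 e - (altExponents W₂).2 e) := by
      intro e
      have hue := hu1 e
      have hve := hv1 e
      have h0 := hzero e
      have hdTe := hdT e
      have k1 := hc₁ e
      have k2 := hc₁' e
      have k3 := hc₂ e
      have k4 := hc₂' e
      rw [hu, Finsupp.add_apply] at hue h0 hdTe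
      rw [hv, Finsupp.add_apply] at hve h0 hdTe
      generalize (altExponents W₁).1 e = n₁ at *
      generalize (altExponents W₁).2 e = n₂ at *
      generalize (altExponents W₂).1 e = n₃ at *
      generalize (altExponents W₂).2 e = n₄ at *
      have hcases : (n₁ = 1 ∧ n₂ = 0 ∧ n₃ = 0 ∧ n₄ = 0) ∨ (n₁ = 0 ∧ n₂ = 1 ∧ n₃ = 0 ∧ n₄ = 0) ∨
          (n₁ = 0 ∧ n₂ = 0 ∧ n₃ = 1 ∧ n₄ = 0) ∨ (n₁ = 0 ∧ n₂ = 0 ∧ n₃ = 0 ∧ n₄ = 1) ∨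
          (n₁ = 0 ∧ n₂ = 0 ∧ n₃ = 0 ∧ n₄ = 0) := by omega
      rcases hcases with ⟨rfl, rfl, rfl, rfl⟩ | ⟨rfl, rfl, rfl, rfl⟩ | ⟨rfl, rfl, rfl, rfl⟩ |
        ⟨rfl, rfl, rfl, rfl⟩ | ⟨rfl, rfl, rfl, rfl⟩
      · simpa using k1 one_ne_zero
      · simpa using k2 one_ne_zero
      · simpa using k3 one_ne_zero
      · simpa using k4 one_ne_zero
      · by_contra hcon
        exact (hdTe (by simpa using hcon)).elim (fun h => h rfl) fun h => h rfl
    -- The kernel equation at `a` reads `2 * c₁ + 2 * c₂ = 0`, since each odd closed walk has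
    -- imbalance two at its base point.
    have hsum : c₁ + c₂ = 0 := by
      have e1 : d = c₁ • ((fun e => ((altExponents W₁).1 e : ℤ)) -
          fun e => ((altExponents W₁).2 e : ℤ)) + c₂ • ((fun e => ((altExponents W₂).1 e : ℤ)) -
          fun e => ((altExponents W₂).2 e : ℤ)) := by
        funext e
        rw [hde e]
        simp
      have e2 := congrFun hker a
      rw [e1, Matrix.mulVec_add, Matrix.mulVec_smul, Matrix.mulVec_smul, Matrix.mulVec_sub,
        Matrix.mulVec_sub, ← multidegree_eq_mulVec, ← multidegree_eq_mulVec,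
        ← multidegree_eq_mulVec, ← multidegree_eq_mulVec] at e2
      simp only [Pi.add_apply, Pi.smul_apply, Pi.sub_apply, multidegree_altExponents,
        hodd₁.neg_one_pow, hodd₂.neg_one_pow, if_true, smul_eq_mul, Pi.zero_apply] at e2
      linarith
    refine ⟨c₁, fun e => ?_⟩
    change d e = _
    obtain rfl : c₂ = -c₁ := by linarith
    rw [hde e, hu, hv, Finsupp.add_apply, Finsupp.add_apply]
    push_cast
    ring
  · push Not at hbig
    have hu0 : u ≠ 0 := by
      rintro rfl
      have := degree_eq_of_multidegree_eq h.1
      rw [map_zero, eq_comm, Finsupp.degree_eq_zero_iff] at this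
      exact hne this.symm
    obtain ⟨⟨e, he⟩, hue⟩ := exists_apply_ne_zero hu0
    obtain ⟨a, ha⟩ : ∃ a, a ∈ e := by
      induction e using Sym2.ind with
      | _ x y => exact ⟨x, by simp⟩
    have hpos : 0 < multidegree (graphMatrix G) u a := by
      have := le_multidegree u (e := ⟨e, he⟩) ha
      omega
    obtain ⟨W, hWpos, hret, hle⟩ := exists_alternating_closed_walk (q := v) (a := a)
      (fun x _ => congrFun h.1 x) hpos
    -- An odd closed walk would force degree at least two at `a`; being even, the walk is balanced
    -- and exhausts the pair.
    have hev : Even W.length := by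
      by_contra hodd
      rw [Nat.not_even_iff_odd] at hodd
      have h1 := multidegree_altExponents W a
      rw [hodd.neg_one_pow] at h1
      simp only [if_true] at h1
      have h2 := multidegree_mono hle.1 a
      have h3 := multidegree_nonneg (altExponents W).2 a
      have h4 := hbig a
      simp only at h2
      linarith
    obtain ⟨hWu, hWv⟩ := h.eq_of_le hle.1 hle.2 (multidegree_eq_of_even_closed W hev)
      (altExponents_snd_ne_zero (by obtain ⟨k, hk⟩ := hev; omega))
    obtain ⟨c, hc, hc'⟩ := altExponents_values W (u := u) (v := v)
      (fun x _ => hlocal x (by have := hbig x; omega)) hle hret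
    rw [hWu] at hc
    rw [hWv] at hc'
    refine ⟨c, fun e => ?_⟩
    change d e = _
    have k1 := hu1 e
    have k2 := hv1 e
    have k3 := hzero e
    by_cases h1 : u e = 0
    · by_cases h2 : v e = 0
      · rw [h1, h2, sub_self, mul_zero]
        by_contra h3
        exact (hdT e h3).elim (fun h => h h1) fun h => h h2
      · have h3 : v e = 1 := by omega
        rw [hc' e h2, h1, h3]
        simp
    · have h2 : v e = 0 := by omega
      have h3 : u e = 1 := by omega
      rw [hc e h1, h2, h3]
      simp

end Unlinked

/-! ### Shortest configurations of two odd closed walks with a connecting walk. -/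

section OddCyclesWithPath

open SimpleGraph

variable {V : Type*} {G : SimpleGraph V}

/-- There is a walk of length `n` from `x` to `y` inside the vertex set `X`. -/
def HasWalkIn (G : SimpleGraph V) (X : Set V) (n : ℕ) (x y : V) : Prop :=
  ∃ w : G.Walk x y, w.length = n ∧ ∀ z ∈ w.support, z ∈ X

namespace HasWalkIn

variable {X Y : Set V} {m n : ℕ} {x y z : V}

lemma refl (hx : x ∈ X) : HasWalkIn G X 0 x x := ⟨.nil, rfl, by simpa using hx⟩

lemma of_adj (h : G.Adj x y) (hx : x ∈ X) (hy : y ∈ X) : HasWalkIn G X 1 x y :=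
  ⟨.cons h .nil, rfl, by simp [hx, hy]⟩

lemma trans (h : HasWalkIn G X m x y) (h' : HasWalkIn G X n y z) : HasWalkIn G X (m + n) x z := by
  obtain ⟨w, rfl, hw⟩ := h
  obtain ⟨w', rfl, hw'⟩ := h'
  refine ⟨w.append w', Walk.length_append _ _, fun v hv => ?_⟩
  rw [Walk.mem_support_append_iff] at hv
  exact hv.elim (hw v) (hw' v)

lemma symm (h : HasWalkIn G X n x y) : HasWalkIn G X n y x := by
  obtain ⟨w, rfl, hw⟩ := h
  exact ⟨w.reverse, Walk.length_reverse _, fun v hv => hw v (by simpa using hv)⟩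

lemma mono (h : HasWalkIn G X n x y) (hXY : X ⊆ Y) : HasWalkIn G Y n x y := by
  obtain ⟨w, hl, hw⟩ := h
  exact ⟨w, hl, fun v hv => hXY (hw v hv)⟩

lemma segment {w : G.Walk x y} (hw : ∀ v ∈ w.support, v ∈ X) {i j : ℕ} (hij : i ≤ j)
    (hj : j ≤ w.length) : HasWalkIn G X (j - i) (w.getVert i) (w.getVert j) := by
  induction j, hij using Nat.le_induction with
  | base =>
    rw [Nat.sub_self]
    exact refl (hw _ (w.getVert_mem_support _))
  | succ j hij ih =>
    rw [Nat.sub_add_comm hij]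
    exact (ih (by omega)).trans (of_adj (w.adj_getVert_succ (by omega))
      (hw _ (w.getVert_mem_support _)) (hw _ (w.getVert_mem_support _)))

end HasWalkIn

/-- Two odd closed walks, the first one inside `A` and the second one inside `B`, together with a
walk inside `S` that connects their base points, with the least possible total length. -/
structure IsMinimalOddPair (S A B : Set V) {x y : V} (c₁ : G.Walk x x) (p : G.Walk x y)
    (c₂ : G.Walk y y) : Prop where
  odd₁ : Odd c₁.length
  odd₂ : Odd c₂.length
  mem₁ : ∀ z ∈ c₁.support, z ∈ A
  mem : ∀ z ∈ p.support, z ∈ S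
  mem₂ : ∀ z ∈ c₂.support, z ∈ B
  min : ∀ x y m k n, Odd m → Odd n → HasWalkIn G A m x x → HasWalkIn G S k x y →
    HasWalkIn G B n y y → c₁.length + p.length + c₂.length ≤ m + k + n

namespace IsMinimalOddPair

variable {S A B : Set V} {x y : V} {c₁ : G.Walk x x} {p : G.Walk x y} {c₂ : G.Walk y y}

lemma symm (h : IsMinimalOddPair S A B c₁ p c₂) :
    IsMinimalOddPair S B A c₂ p.reverse c₁ where
  odd₁ := h.odd₂
  odd₂ := h.odd₁
  mem₁ := h.mem₂
  mem z hz := h.mem z (by simpa using hz)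
  mem₂ := h.mem₁
  min x y m k n hm hn h1 h2 h3 := by
    have := h.min y x n k m hn hm h3 h2.symm h1
    rw [Walk.length_reverse]
    omega

lemma min_left (h : IsMinimalOddPair S A B c₁ p c₂) {z : V} {m k : ℕ} (hm : Odd m)
    (h1 : HasWalkIn G A m z z) (h2 : HasWalkIn G S k z y) :
    c₁.length + p.length ≤ m + k := by
  have := h.min z y m k c₂.length hm h.odd₂ h1 h2 ⟨c₂, rfl, h.mem₂⟩
  omega

lemma hasWalkIn_path (h : IsMinimalOddPair S A B c₁ p c₂) : HasWalkIn G S p.length x y :=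
  ⟨p, rfl, h.mem⟩

/-- A repeated vertex splits the closed walk in two parts, one of them odd. An even inner part can
be deleted; an odd one replaces `c₁`, with a remaining stretch prepended to the path. -/
lemma eq_of_getVert_eq (h : IsMinimalOddPair S A B c₁ p c₂) (hAS : A ⊆ S) {i j : ℕ} (hij : i < j)
    (hj : j ≤ c₁.length) (he : c₁.getVert i = c₁.getVert j) : i = 0 ∧ j = c₁.length := by
  by_contra hcon
  have hodd := h.odd₁
  have w1 := HasWalkIn.segment h.mem₁ (Nat.zero_le i) (hij.le.trans hj)
  have w2 := HasWalkIn.segment h.mem₁ hij.le hj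
  have w3 := HasWalkIn.segment h.mem₁ hj le_rfl
  rw [Walk.getVert_zero] at w1
  rw [Walk.getVert_length] at w3
  rcases Nat.even_or_odd (j - i) with hp | hp
  · rw [← he] at w3
    have := h.min_left (by grind) (w1.trans w3) h.hasWalkIn_path
    omega
  · rw [← he] at w2 w3
    by_cases hjm : j = c₁.length
    · have := h.min_left hp w2 ((w3.mono hAS).trans h.hasWalkIn_path)
      omega
    · have := h.min_left hp w2 ((w1.symm.mono hAS).trans h.hasWalkIn_path)
      omega

lemma isCycle (h : IsMinimalOddPair S A B c₁ p c₂) (hAS : A ⊆ S) : c₁.IsCycle := by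
  have hodd := h.odd₁
  have h1 : c₁.length ≠ 1 := by
    intro h1
    have := c₁.adj_getVert_succ (i := 0) (by omega)
    rw [zero_add, ← h1, Walk.getVert_length, Walk.getVert_zero] at this
    exact this.ne rfl
  have h3 : 3 ≤ c₁.length := by
    obtain ⟨k, hk⟩ := hodd
    omega
  have hnil : ¬ c₁.Nil := by
    rw [← Walk.length_eq_zero_iff]
    omega
  rw [Walk.isCycle_iff_isPath_tail_and_le_length]
  refine ⟨?_, h3⟩
  rw [← Walk.IsPath.getVert_injOn_iff]
  have hl := Walk.length_tail_add_one hnil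
  have key : ∀ i j, i < j → j ≤ c₁.tail.length → c₁.tail.getVert i ≠ c₁.tail.getVert j := by
    intro i j hij hj he
    rw [Walk.getVert_tail, Walk.getVert_tail] at he
    have := h.eq_of_getVert_eq hAS (by omega) (by omega) he
    omega
  intro i hi j hj he
  by_contra hne
  rcases Nat.lt_or_gt_of_ne hne with hlt | hlt
  · exact key i j hlt hj he
  · exact key j i hlt hi he.symm

/-- A chord replaces an odd arc `i..j`, or closes an even one to an odd closed walk reached along
either remaining stretch. Minimality leaves only edges of the cycle, including those that pass over
the base point. -/
lemma toSubgraph_adj (h : IsMinimalOddPair S A B c₁ p c₂) (hAS : A ⊆ S) {v w : V}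
    (hv : v ∈ c₁.support) (hw : w ∈ c₁.support) (hadj : G.Adj v w) :
    c₁.toSubgraph.Adj v w := by
  have hodd := h.odd₁
  have key : ∀ i j, i < j → j ≤ c₁.length → G.Adj (c₁.getVert i) (c₁.getVert j) →
      c₁.toSubgraph.Adj (c₁.getVert i) (c₁.getVert j) := by
    intro i j hij hj hadj
    have w1 := HasWalkIn.segment h.mem₁ (Nat.zero_le i) (hij.le.trans hj)
    have w2 := HasWalkIn.segment h.mem₁ hij.le hj
    have w3 := HasWalkIn.segment h.mem₁ hj le_rfl
    have w4 := HasWalkIn.of_adj hadj (h.mem₁ _ (c₁.getVert_mem_support i))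
      (h.mem₁ _ (c₁.getVert_mem_support j))
    rw [Walk.getVert_zero] at w1
    rw [Walk.getVert_length] at w3
    rcases Nat.even_or_odd (j - i) with hp | hp
    · have h1 := h.min_left (by grind) (w2.trans w4.symm)
        ((w1.symm.mono hAS).trans h.hasWalkIn_path)
      have h2 := h.min_left (by grind) (w4.symm.trans w2)
        ((w3.mono hAS).trans h.hasWalkIn_path)
      have : (i = 0 ∧ j + 1 = c₁.length) ∨ (i = 1 ∧ j = c₁.length) := by
        obtain ⟨a, ha⟩ := hp
        obtain ⟨b, hb⟩ := hodd
        omega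
      rcases this with ⟨rfl, hj'⟩ | ⟨rfl, rfl⟩
      · have := (c₁.toSubgraph_adj_getVert (i := j) (by omega)).symm
        rwa [hj', Walk.getVert_length, ← congrArg (c₁.toSubgraph.Adj · _) c₁.getVert_zero] at this
      · have := (c₁.toSubgraph_adj_getVert (i := 0) (by omega)).symm
        rwa [zero_add, Walk.getVert_zero, ← congrArg (c₁.toSubgraph.Adj _) c₁.getVert_length]
          at this
    · have h1 := h.min_left (by grind) ((w1.trans w4).trans w3) h.hasWalkIn_path
      obtain rfl : j = i + 1 := by
        obtain ⟨a, ha⟩ := hp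
        omega
      exact c₁.toSubgraph_adj_getVert (by omega)
  obtain ⟨i, rfl, hi⟩ := Walk.mem_support_iff_exists_getVert.1 hv
  obtain ⟨j, rfl, hj⟩ := Walk.mem_support_iff_exists_getVert.1 hw
  rcases Nat.lt_trichotomy i j with hlt | heq | hlt
  · exact key i j hlt hj hadj
  · subst heq
    exact absurd rfl hadj.ne
  · exact (key j i hlt hi hadj.symm).symm

lemma isPath (h : IsMinimalOddPair S A B c₁ p c₂) : p.IsPath := by
  have key : ∀ i j, i < j → j ≤ p.length → p.getVert i ≠ p.getVert j := by
    intro i j hij hj he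
    have w1 := HasWalkIn.segment h.mem (Nat.zero_le i) (hij.le.trans hj)
    have w3 := HasWalkIn.segment h.mem hj le_rfl
    rw [Walk.getVert_zero, he] at w1
    rw [Walk.getVert_length] at w3
    have := h.min_left h.odd₁ ⟨c₁, rfl, h.mem₁⟩ (w1.trans w3)
    omega
  rw [← Walk.IsPath.getVert_injOn_iff]
  intro i hi j hj he
  by_contra hne
  rcases Nat.lt_or_gt_of_ne hne with hlt | hlt
  · exact key i j hlt hj he
  · exact key j i hlt hi he.symm

lemma path_toSubgraph_adj (h : IsMinimalOddPair S A B c₁ p c₂) {v w : V}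
    (hv : v ∈ p.support) (hw : w ∈ p.support) (hadj : G.Adj v w) : p.toSubgraph.Adj v w := by
  have key : ∀ i j, i < j → j ≤ p.length → G.Adj (p.getVert i) (p.getVert j) →
      p.toSubgraph.Adj (p.getVert i) (p.getVert j) := by
    intro i j hij hj hadj
    have w1 := HasWalkIn.segment h.mem (Nat.zero_le i) (hij.le.trans hj)
    have w3 := HasWalkIn.segment h.mem hj le_rfl
    have w4 := HasWalkIn.of_adj hadj (h.mem _ (p.getVert_mem_support i))
      (h.mem _ (p.getVert_mem_support j))
    rw [Walk.getVert_zero] at w1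
    rw [Walk.getVert_length] at w3
    have := h.min_left h.odd₁ ⟨c₁, rfl, h.mem₁⟩ ((w1.trans w4).trans w3)
    obtain rfl : j = i + 1 := by omega
    exact p.toSubgraph_adj_getVert (by omega)
  obtain ⟨i, rfl, hi⟩ := Walk.mem_support_iff_exists_getVert.1 hv
  obtain ⟨j, rfl, hj⟩ := Walk.mem_support_iff_exists_getVert.1 hw
  rcases Nat.lt_trichotomy i j with hlt | heq | hlt
  · exact key i j hlt hj hadj
  · subst heq
    exact absurd rfl hadj.ne
  · exact (key j i hlt hi hadj.symm).symm

lemma hasWalkIn_rotate (h : IsMinimalOddPair S A B c₁ p c₂) {v : V} (hv : v ∈ c₁.support) :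
    HasWalkIn G A c₁.length v v := by
  obtain ⟨i, rfl, hi⟩ := Walk.mem_support_iff_exists_getVert.1 hv
  have w1 := HasWalkIn.segment h.mem₁ (Nat.zero_le i) hi
  have w3 := HasWalkIn.segment h.mem₁ hi le_rfl
  rw [Walk.getVert_zero] at w1
  rw [Walk.getVert_length] at w3
  have := w3.trans w1
  rwa [show c₁.length - i + (i - 0) = c₁.length by omega] at this

lemma eq_zero_of_getVert_mem (h : IsMinimalOddPair S A B c₁ p c₂) {t : ℕ} (ht : t ≤ p.length)
    (hmem : p.getVert t ∈ c₁.support) : t = 0 := by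
  have w3 := HasWalkIn.segment h.mem ht le_rfl
  rw [Walk.getVert_length] at w3
  have := h.min_left h.odd₁ (h.hasWalkIn_rotate hmem) w3
  omega

lemma eq_of_mem (h : IsMinimalOddPair S A B c₁ p c₂) {v : V} (hv : v ∈ p.support)
    (hv' : v ∈ c₁.support) : v = x := by
  obtain ⟨t, rfl, ht⟩ := Walk.mem_support_iff_exists_getVert.1 hv
  rw [h.eq_zero_of_getVert_mem ht hv', Walk.getVert_zero]

/-- Rebasing the cycle at `v` and using the edge as a shortcut shows `t ≤ 1`. If `t = 1` and `v ≠
x`, the odd arc between `x` and `v`, closed through `p.getVert 1`, gives a smaller configuration. -/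
lemma sup_adj (h : IsMinimalOddPair S A B c₁ p c₂) (hAS : A ⊆ S) {a : V}
    (hA : ∀ x ∈ A, x ≠ a → ∀ y ∈ S, G.Adj x y → y ∈ A) {v w : V}
    (hv : v ∈ c₁.support) (hw : w ∈ p.support) (hadj : G.Adj v w) :
    c₁.toSubgraph.Adj v w ∨ p.toSubgraph.Adj v w := by
  obtain ⟨t, rfl, ht⟩ := Walk.mem_support_iff_exists_getVert.1 hw
  have hvA := h.mem₁ v hv
  have w3 := HasWalkIn.segment h.mem ht le_rfl
  rw [Walk.getVert_length] at w3
  have h1 := h.min_left h.odd₁ (h.hasWalkIn_rotate hv)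
    ((HasWalkIn.of_adj hadj (hAS hvA) (h.mem _ (p.getVert_mem_support t))).trans w3)
  rcases Nat.eq_zero_or_pos t with rfl | htpos
  · left
    rw [Walk.getVert_zero] at hadj ⊢
    exact h.toSubgraph_adj hAS hv c₁.start_mem_support hadj
  · obtain rfl : t = 1 := by omega
    right
    have hedge := p.toSubgraph_adj_getVert (i := 0) (by omega)
    rw [zero_add, Walk.getVert_zero] at hedge
    by_cases hvx : v = x
    · rwa [hvx]
    · exfalso
      have hxA := h.mem₁ x c₁.start_mem_support
      have hpS := h.mem _ (p.getVert_mem_support 1)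
      -- At least one of `v`, `x` differs from the attaching vertex `a`, so their common neighbour
      -- stays in `A`, as the new closed walk requires.
      have hpA : p.getVert 1 ∈ A := by
        by_cases hxa : x = a
        · exact hA v hvA (fun hva => hvx (hva.trans hxa.symm)) _ hpS hadj
        · exact hA x hxA hxa _ hpS (p.toSubgraph.adj_sub hedge)
      obtain ⟨i, rfl, hi⟩ := Walk.mem_support_iff_exists_getVert.1 hv
      have w1 := HasWalkIn.segment h.mem₁ (Nat.zero_le i) hi
      have w2 := HasWalkIn.segment h.mem₁ hi le_rfl
      rw [Walk.getVert_zero] at w1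
      rw [Walk.getVert_length] at w2
      have e1 := HasWalkIn.of_adj hadj hvA hpA
      have e2 := HasWalkIn.of_adj (p.toSubgraph.adj_sub hedge) hxA hpA
      have hi0 : i ≠ 0 := by
        rintro rfl
        exact hvx c₁.getVert_zero
      have him : i ≠ c₁.length := by
        rintro rfl
        exact hvx c₁.getVert_length
      have hodd := h.odd₁
      rcases Nat.even_or_odd i with hp | hp
      · have := h.min_left (by grind) ((e1.symm.trans w2).trans e2) w3
        obtain ⟨k, hk⟩ := hp
        omega
      · have := h.min_left (by grind) ((e2.symm.trans w1).trans e1) w3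
        obtain ⟨k, hk⟩ := hp
        obtain ⟨l, hl⟩ := hodd
        omega

/-- The only possible edge between `A` and `B` is `ab`. If it joins the cycles, minimality forces
the path to be a single edge, which must again be `ab`. -/
lemma path_adj_of_adj (h : IsMinimalOddPair S A B c₁ p c₂) (hAS : A ⊆ S) (hBS : B ⊆ S)
    (hAB : Disjoint A B) {a b : V} (hA : ∀ x ∈ A, x ≠ a → ∀ y ∈ S, G.Adj x y → y ∈ A)
    (hB : ∀ x ∈ B, x ≠ b → ∀ y ∈ S, G.Adj x y → y ∈ B) {v w : V}
    (hv : v ∈ c₁.support) (hw : w ∈ c₂.support) (hadj : G.Adj v w) : p.toSubgraph.Adj v w := by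
  have hcut : ∀ v ∈ A, ∀ w ∈ B, G.Adj v w → v = a ∧ w = b := by
    intro v hv w hw hadj
    constructor
    · by_contra hne
      exact Set.disjoint_left.1 hAB (hA v hv hne w (hBS hw) hadj) hw
    · by_contra hne
      exact Set.disjoint_left.1 hAB hv (hB w hw hne v (hAS hv) hadj.symm)
  have hvA := h.mem₁ v hv
  have hwB := h.mem₂ w hw
  have h1 := h.min v w _ 1 _ h.odd₁ h.odd₂ (h.hasWalkIn_rotate hv)
    (HasWalkIn.of_adj hadj (hAS hvA) (hBS hwB)) (h.symm.hasWalkIn_rotate hw)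
  have hxA := h.mem₁ x c₁.start_mem_support
  have hyB := h.mem₂ y c₂.start_mem_support
  have hp0 : p.length ≠ 0 := by
    intro h0
    have := Walk.eq_of_length_eq_zero h0
    subst this
    exact Set.disjoint_left.1 hAB hxA hyB
  have hp1 : p.length = 1 := by omega
  have hedge := p.toSubgraph_adj_getVert (i := 0) (by omega)
  rw [zero_add, Walk.getVert_zero, ← hp1, Walk.getVert_length] at hedge
  have h2 := hcut v hvA w hwB hadj
  have h3 := hcut x hxA y hyB (p.toSubgraph.adj_sub hedge)
  rwa [h2.1, h2.2, ← h3.1, ← h3.2]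

end IsMinimalOddPair

/-- If `S` contains two disjoint sets, both attached to the rest of `S` by a single vertex only and
both containing an odd closed walk, then there is an induced subgraph consisting of two odd cycles
and a path that connects them. -/
theorem exists_isInduced_isOddCyclesWithPath {S A B : Set V} {a b : V} (hAS : A ⊆ S) (hBS : B ⊆ S)
    (hAB : Disjoint A B) (hA : ∀ x ∈ A, x ≠ a → ∀ y ∈ S, G.Adj x y → y ∈ A)
    (hB : ∀ x ∈ B, x ≠ b → ∀ y ∈ S, G.Adj x y → y ∈ B) {x y : V} {m k n : ℕ}
    (hm : Odd m) (hn : Odd n) (h1 : HasWalkIn G A m x x) (h2 : HasWalkIn G S k x y)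
    (h3 : HasWalkIn G B n y y) :
    ∃ H : G.Subgraph, H.IsInduced ∧ IsOddCyclesWithPath H := by
  classical
  have hex : ∃ N x y m k n, Odd m ∧ Odd n ∧ HasWalkIn G A m x x ∧ HasWalkIn G S k x y ∧
      HasWalkIn G B n y y ∧ N = m + k + n := ⟨_, x, y, m, k, n, hm, hn, h1, h2, h3, rfl⟩
  obtain ⟨x, y, _, _, _, hm, hn, ⟨c₁, rfl, hc₁⟩, ⟨p, rfl, hp⟩, ⟨c₂, rfl, hc₂⟩, hN⟩ :=
    Nat.find_spec hex
  have h : IsMinimalOddPair S A B c₁ p c₂ :=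
    { odd₁ := hm
      odd₂ := hn
      mem₁ := hc₁
      mem := hp
      mem₂ := hc₂
      min := fun x y m k n hm hn h1 h2 h3 => by
        rw [← hN]
        exact Nat.find_min' hex ⟨x, y, m, k, n, hm, hn, h1, h2, h3, rfl⟩ }
  have hdisj : ∀ v ∈ c₁.support, v ∉ c₂.support := fun v hv hv' =>
    Set.disjoint_left.1 hAB (hc₁ v hv) (hc₂ v hv')
  have hp1 : 1 ≤ p.length := by
    by_contra h0
    have := Walk.eq_of_length_eq_zero (p := p) (by omega)
    subst this
    exact hdisj x c₁.start_mem_support c₂.start_mem_support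
  have h12 : ∀ v ∈ c₁.support, ∀ w ∈ c₂.support, G.Adj v w → p.toSubgraph.Adj v w :=
    fun v hv w hw hadj => h.path_adj_of_adj hAS hBS hAB hA hB hv hw hadj
  have h1p : ∀ v ∈ c₁.support, ∀ w ∈ p.support, G.Adj v w →
      c₁.toSubgraph.Adj v w ∨ p.toSubgraph.Adj v w :=
    fun v hv w hw hadj => h.sup_adj hAS hA hv hw hadj
  have h2p : ∀ v ∈ c₂.support, ∀ w ∈ p.support, G.Adj v w →
      c₂.toSubgraph.Adj v w ∨ p.toSubgraph.Adj v w := by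
    intro v hv w hw hadj
    have := h.symm.sup_adj hBS hB hv (by simpa using hw) hadj
    rwa [Walk.toSubgraph_reverse] at this
  refine ⟨c₁.toSubgraph ⊔ p.toSubgraph ⊔ c₂.toSubgraph, ?_, x, y, c₁, c₂, p, h.isCycle hAS, hm,
    h.symm.isCycle hBS, hn, hdisj, h.isPath, hp1, fun v hv hv' => h.eq_of_mem hv hv',
    fun v hv hv' => h.symm.eq_of_mem (by simpa using hv) hv', rfl⟩
  intro v hv w hw hadj
  simp only [Subgraph.verts_sup, Walk.verts_toSubgraph, Set.mem_union, Set.mem_ofPred_eq,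
    Subgraph.sup_adj] at hv hw ⊢
  rcases hv with (hv | hv) | hv <;> rcases hw with (hw | hw) | hw
  · exact .inl (.inl (h.toSubgraph_adj hAS hv hw hadj))
  · exact .inl (h1p v hv w hw hadj)
  · exact .inl (.inr (h12 v hv w hw hadj))
  · exact .inl ((h1p w hw v hv hadj.symm).imp Subgraph.Adj.symm Subgraph.Adj.symm)
  · exact .inl (.inr (h.path_toSubgraph_adj hv hw hadj))
  · rcases h2p w hw v hv hadj.symm with h' | h'
    · exact .inr h'.symm
    · exact .inl (.inr h'.symm)
  · exact .inl (.inr (h12 w hw v hv hadj.symm).symm)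
  · rcases h2p v hv w hw hadj with h' | h'
    · exact .inr h'
    · exact .inl (.inr h')
  · exact .inr (h.symm.toSubgraph_adj hBS hv hw hadj)

/-- An unlinked pair with two vertices of degree at least two produces an induced subgraph
consisting of two odd cycles and a path that connects them. -/
lemma Unlinked.exists_isOddCyclesWithPath [Finite V] {u v : G.edgeSet →₀ ℕ} (h : Unlinked u v)
    {a b : V} (hab : a ≠ b) (ha : 2 ≤ multidegree (graphMatrix G) u a)
    (hb : 2 ≤ multidegree (graphMatrix G) u b) :
    ∃ H : G.Subgraph, H.IsInduced ∧ IsOddCyclesWithPath H := by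
  classical
  obtain ⟨W, W', hodd, hbW, hbW', hW, hW', hsep⟩ :=
    h.exists_separation (b := b) ha (by omega) hab.symm
  obtain ⟨U, U', hodd', haU, -, hU, -, hsep'⟩ :=
    h.exists_separation (b := a) hb (by omega) hab
  -- The side `W` can be entered only through `a`; as `U` starts at `b` outside `W` and avoids `a`,
  -- it never meets `W`.
  have hout : ∀ {x y : V} (q : G.Walk x y), x ∉ W.support →
      (∀ z ∈ q.support, 0 < multidegree (graphMatrix G) u z ∧ z ≠ a) → y ∉ W.support := by
    intro x y q
    induction q with
    | nil => exact fun hx _ => hx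
    | @cons x z y hadj q ih =>
      intro hx hq
      refine ih (fun hz => hx ?_) fun w hw => hq w (by simp [hw])
      exact hsep z hz (hq z (by simp)).2 x (hq x (by simp)).1 hadj.symm
  have hdisj : Disjoint {x | x ∈ W.support} {x | x ∈ U.support} := by
    rw [Set.disjoint_left]
    intro z hz hzU
    refine hout (U.takeUntil z hzU) hbW (fun w hw => ?_) hz
    have hwU := U.support_takeUntil_subset_support hzU hw
    exact ⟨hU w hwU, fun hwa => haU (hwa ▸ hwU)⟩
  refine exists_isInduced_isOddCyclesWithPath (S := {x | 0 < multidegree (graphMatrix G) u x})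
    hW hU hdisj hsep hsep' hodd hodd' ⟨W, rfl, fun z hz => hz⟩
    ⟨W'.takeUntil b hbW', rfl, fun z hz => hW' z (W'.support_takeUntil_subset_support hbW' hz)⟩
    ⟨U, rfl, fun z hz => hz⟩

end OddCyclesWithPath

/-! ### The fundamental circuit of an induced pair of odd cycles with a path. -/

section InducedOddCycles

open SimpleGraph

variable {V : Type*} {G : SimpleGraph V}

open Classical in
/-- Extension by zero of a function on the edges of a graph to all unordered pairs. -/
noncomputable def extendEdges (z : G.edgeSet → ℤ) (e : Sym2 V) : ℤ :=
  if h : e ∈ G.edgeSet then z ⟨e, h⟩ else 0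

lemma extendEdges_apply (z : G.edgeSet → ℤ) (e : G.edgeSet) : extendEdges z e = z e := by
  simp [extendEdges]

/-- The kernel equation at `x` summed over neighbours: `s` need only catch the neighbours in `H`,
because `z` vanishes on all other edges. -/
lemma sum_extendEdges [Fintype G.edgeSet] {z : G.edgeSet → ℤ}
    (hz : (graphMatrix G).mulVec z = 0) {H : G.Subgraph}
    (hH : ∀ e : G.edgeSet, z e ≠ 0 → (e : Sym2 V) ∈ H.edgeSet) {x : V} (s : Finset V)
    (hs : ∀ y ∈ s, G.Adj x y) (hs' : ∀ y, H.Adj x y → y ∈ s) :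
    ∑ y ∈ s, extendEdges z s(x, y) = 0 := by
  classical
  rw [← show (graphMatrix G).mulVec z x = 0 from congrFun hz x, mulVec_apply_eq_sum z x
    (Finset.univ.filter fun e : G.edgeSet => ∃ y ∈ s, (e : Sym2 V) = s(x, y))]
  · refine Finset.sum_bij (fun y hy => ⟨s(x, y), G.mem_edgeSet.2 (hs y hy)⟩) ?_ ?_ ?_ ?_
    · intro y hy
      simp only [Finset.mem_filter, Finset.mem_univ, true_and]
      exact ⟨y, hy, rfl⟩
    · intro y _ y' _ h
      exact Sym2.congr_right.1 (congrArg Subtype.val h)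
    · rintro e he
      simp only [Finset.mem_filter, Finset.mem_univ, true_and] at he
      obtain ⟨y, hy, he⟩ := he
      exact ⟨y, hy, Subtype.ext he.symm⟩
    · intro y hy
      exact extendEdges_apply z ⟨s(x, y), G.mem_edgeSet.2 (hs y hy)⟩
  · intro e he
    simp only [Finset.mem_filter, Finset.mem_univ, true_and] at he
    obtain ⟨y, _, he⟩ := he
    simp [he]
  · rintro e hx he
    obtain ⟨y, hy⟩ := Sym2.mem_iff_exists.1 hx
    simp only [Finset.mem_filter, Finset.mem_univ, true_and]
    have := hH e he
    rw [hy, Subgraph.mem_edgeSet] at this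
    exact ⟨y, hs' y this, hy⟩

lemma eq_neg_one_pow_mul {x y : V} {w : G.Walk x y} {D : Sym2 V → ℤ}
    (h : ∀ i, i + 1 < w.length →
      D s(w.getVert i, w.getVert (i + 1)) + D s(w.getVert (i + 1), w.getVert (i + 2)) = 0) :
    ∀ i, i < w.length →
      D s(w.getVert i, w.getVert (i + 1)) = (-1) ^ i * D s(w.getVert 0, w.getVert 1) := by
  intro i
  induction i with
  | zero => simp
  | succ i ih =>
    intro hi
    have h1 := h i hi
    rw [ih (by omega)] at h1
    rw [pow_succ]
    linarith

section Alternation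

variable [Fintype G.edgeSet] {z : G.edgeSet → ℤ} {H : G.Subgraph}

lemma cycle_alternation (hz : (graphMatrix G).mulVec z = 0)
    (hH : ∀ e : G.edgeSet, z e ≠ 0 → (e : Sym2 V) ∈ H.edgeSet) {a : V} {c : G.Walk a a}
    (hc : c.IsCycle)
    (hloc : ∀ x ∈ c.support, x ≠ a → ∀ y, H.Adj x y → c.toSubgraph.Adj x y) :
    ∀ i, i < c.length → extendEdges z s(c.getVert i, c.getVert (i + 1)) =
      (-1) ^ i * extendEdges z s(c.getVert 0, c.getVert 1) := by
  classical
  refine eq_neg_one_pow_mul fun i hi => ?_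
  have hne := hc.getVert_sub_one_ne_getVert_add_one (i := i + 1) (by omega)
  have hset := hc.neighborSet_toSubgraph_internal (i := i + 1) (by omega) hi
  rw [Nat.add_sub_cancel] at hne hset
  have ha : c.getVert (i + 1) ≠ a := by
    intro h
    have := (hc.getVert_endpoint_iff (by omega)).1 h
    omega
  rw [Sym2.eq_swap, ← Finset.sum_pair (f := fun y => extendEdges z s(c.getVert (i + 1), y)) hne]
  refine sum_extendEdges hz hH _ ?_ ?_
  · intro y hy
    have : y ∈ c.toSubgraph.neighborSet (c.getVert (i + 1)) := by
      rw [hset]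
      simpa using hy
    exact c.toSubgraph.adj_sub this
  · intro y hy
    have : y ∈ c.toSubgraph.neighborSet (c.getVert (i + 1)) :=
      hloc _ (c.getVert_mem_support _) ha y hy
    rw [hset] at this
    simpa using this

lemma path_alternation (hz : (graphMatrix G).mulVec z = 0)
    (hH : ∀ e : G.edgeSet, z e ≠ 0 → (e : Sym2 V) ∈ H.edgeSet) {a b : V} {p : G.Walk a b}
    (hp : p.IsPath)
    (hloc : ∀ x ∈ p.support, x ≠ a → x ≠ b → ∀ y, H.Adj x y → p.toSubgraph.Adj x y) :
    ∀ i, i < p.length → extendEdges z s(p.getVert i, p.getVert (i + 1)) =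
      (-1) ^ i * extendEdges z s(p.getVert 0, p.getVert 1) := by
  classical
  refine eq_neg_one_pow_mul fun i hi => ?_
  have hne : p.getVert i ≠ p.getVert (i + 2) := by
    intro h
    have := hp.getVert_injOn (by rw [Set.mem_ofPred_eq]; omega) (by rw [Set.mem_ofPred_eq]; omega) h
    omega
  have hset := hp.neighborSet_toSubgraph_internal (i := i + 1) (by omega) hi
  rw [Nat.add_sub_cancel] at hset
  have ha : p.getVert (i + 1) ≠ a := by
    intro h
    have := (hp.getVert_eq_start_iff (by omega)).1 h
    omega
  have hb : p.getVert (i + 1) ≠ b := by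
    intro h
    have := (hp.getVert_eq_end_iff (by omega)).1 h
    omega
  rw [Sym2.eq_swap, ← Finset.sum_pair (f := fun y => extendEdges z s(p.getVert (i + 1), y)) hne]
  refine sum_extendEdges hz hH _ ?_ ?_
  · intro y hy
    have : y ∈ p.toSubgraph.neighborSet (p.getVert (i + 1)) := by
      rw [hset]
      simpa using hy
    exact p.toSubgraph.adj_sub this
  · intro y hy
    have : y ∈ p.toSubgraph.neighborSet (p.getVert (i + 1)) :=
      hloc _ (p.getVert_mem_support _) ha hb y hy
    rw [hset] at this
    simpa using this

/-- At the vertex where the path is attached to an odd cycle, the value on the path is determined by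
the value on the cycle. -/
lemma two_mul_add_eq_zero (hz : (graphMatrix G).mulVec z = 0)
    (hH : ∀ e : G.edgeSet, z e ≠ 0 → (e : Sym2 V) ∈ H.edgeSet) {a b : V} {c : G.Walk a a}
    {p : G.Walk a b} (hc : c.IsCycle) (hodd : Odd c.length) (hp : p.IsPath) (hp1 : 1 ≤ p.length)
    (hpc : ∀ x ∈ p.support, x ∈ c.support → x = a)
    (hloc : ∀ x ∈ c.support, x ≠ a → ∀ y, H.Adj x y → c.toSubgraph.Adj x y)
    (hloc' : ∀ y, H.Adj a y → c.toSubgraph.Adj a y ∨ p.toSubgraph.Adj a y) :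
    2 * extendEdges z s(a, c.snd) + extendEdges z s(a, p.snd) = 0 := by
  classical
  have hpnil : ¬ p.Nil := by
    rw [← Walk.length_eq_zero_iff]
    omega
  have hadj1 := c.adj_snd hc.not_nil
  have hadj2 := c.adj_penultimate hc.not_nil
  have hadj3 := p.adj_snd hpnil
  have hps : p.snd ∉ c.support := fun h => hadj3.ne (hpc _ (p.getVert_mem_support 1) h).symm
  have h1 : c.snd ≠ c.penultimate := hc.snd_ne_penultimate
  have h2 : c.snd ≠ p.snd := fun h => hps (h ▸ c.getVert_mem_support 1)
  have h3 : c.penultimate ≠ p.snd := fun h => hps (h ▸ c.getVert_mem_support _)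
  have hsum := sum_extendEdges hz hH (x := a) {c.snd, c.penultimate, p.snd} (by
    intro y hy
    simp only [Finset.mem_insert, Finset.mem_singleton] at hy
    rcases hy with rfl | rfl | rfl
    · exact hadj1
    · exact hadj2.symm
    · exact hadj3) (by
    intro y hy
    simp only [Finset.mem_insert, Finset.mem_singleton]
    rcases hloc' y hy with h | h
    · have : y ∈ c.toSubgraph.neighborSet a := h
      rw [hc.neighborSet_toSubgraph_endpoint] at this
      simp only [Set.mem_insert_iff, Set.mem_singleton_iff] at this
      tauto
    · have : y ∈ p.toSubgraph.neighborSet a := h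
      rw [hp.neighborSet_toSubgraph_startpoint hpnil] at this
      simp only [Set.mem_singleton_iff] at this
      tauto)
  rw [Finset.sum_insert (by simp [h1, h2]), Finset.sum_pair h3] at hsum
  have hlen : 0 < c.length := by
    obtain ⟨k, hk⟩ := hodd
    omega
  -- The last edge of an odd cycle has even index, so it carries the same value as the first.
  have halt := cycle_alternation hz hH hc hloc (c.length - 1) (by omega)
  have hev : Even (c.length - 1) := by
    obtain ⟨k, hk⟩ := hodd
    exact ⟨k, by omega⟩
  rw [hev.neg_one_pow, one_mul, Nat.sub_add_cancel hlen, Walk.getVert_length, Walk.getVert_zero,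
    Sym2.eq_swap] at halt
  change extendEdges z s(a, c.penultimate) = extendEdges z s(a, c.snd) at halt
  linarith

end Alternation

lemma altExponents_append_sub {a : V} {c r : G.Walk a a} (hc : c.IsCycle) (e : G.edgeSet)
    (he : (e : Sym2 V) = s(a, c.snd)) (hr : (e : Sym2 V) ∉ r.edges) :
    ((altExponents (c.append r)).1 e : ℤ) - (altExponents (c.append r)).2 e = 1 := by
  cases c with
  | nil => exact absurd hc (by simp)
  | @cons _ y _ h q =>
    rw [Walk.cons_isCycle_iff] at hc
    rw [Walk.snd_cons] at he
    have h1 : (e : Sym2 V) ∉ (q.append r).edges := by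
      rw [Walk.edges_append, List.mem_append, not_or]
      exact ⟨by rw [he]; exact hc.2, hr⟩
    rw [mem_edges_iff_altExponents] at h1
    push Not at h1
    have h2 : e = ⟨s(a, y), G.mem_edgeSet.2 h⟩ := Subtype.ext he
    rw [Walk.cons_append, altExponents_cons, Finsupp.add_apply, h1.1, h1.2, h2]
    simp

/-- An induced subgraph consisting of two odd cycles and a path that connects them supports a
fundamental circuit which is not squarefree. -/
theorem exists_isFundamental_of_isOddCyclesWithPath [Finite V] (K : Type*) [Field K]
    {H : G.Subgraph} (hind : H.IsInduced) (hH : IsOddCyclesWithPath H) :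
    ∃ f ∈ circuits K (graphMatrix G) \ squarefreeCircuits K (graphMatrix G),
      IsFundamental (graphMatrix G) f := by
  classical
  have := Fintype.ofFinite G.edgeSet
  obtain ⟨a, b, c₁, c₂, p, hc₁, hodd₁, hc₂, hodd₂, hdisj, hp, hp1, hpa, hpb, hHeq⟩ := hH
  have hadj : ∀ x y, H.Adj x y ↔
      c₁.toSubgraph.Adj x y ∨ p.toSubgraph.Adj x y ∨ c₂.toSubgraph.Adj x y := by
    intro x y
    rw [hHeq, Subgraph.sup_adj, Subgraph.sup_adj, or_assoc]
  have hvert : ∀ {x y : V} {s t : V} {w : G.Walk s t}, w.toSubgraph.Adj x y → x ∈ w.support :=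
    fun h => (Walk.mem_verts_toSubgraph _).1 (Subgraph.edge_vert _ h)
  have hpnil : ¬ p.Nil := by
    rw [← Walk.length_eq_zero_iff]
    omega
  have hac₂ : a ∉ c₂.support := hdisj a c₁.start_mem_support
  have hbc₁ : b ∉ c₁.support := fun h => hdisj b h c₂.start_mem_support
  have hloc₁ : ∀ x ∈ c₁.support, x ≠ a → ∀ y, H.Adj x y → c₁.toSubgraph.Adj x y := by
    intro x hx hxa y hxy
    rcases (hadj x y).1 hxy with h | h | h
    · exact h
    · exact absurd (hpa x (hvert h) hx) hxa
    · exact absurd (hvert h) (hdisj x hx)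
  have hloc₂ : ∀ x ∈ c₂.support, x ≠ b → ∀ y, H.Adj x y → c₂.toSubgraph.Adj x y := by
    intro x hx hxb y hxy
    rcases (hadj x y).1 hxy with h | h | h
    · exact absurd hx (hdisj x (hvert h))
    · exact absurd (hpb x (hvert h) hx) hxb
    · exact h
  have hlocp : ∀ x ∈ p.support, x ≠ a → x ≠ b → ∀ y, H.Adj x y → p.toSubgraph.Adj x y := by
    intro x hx hxa hxb y hxy
    rcases (hadj x y).1 hxy with h | h | h
    · exact absurd (hpa x hx (hvert h)) hxa
    · exact h
    · exact absurd (hpb x hx (hvert h)) hxb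
  have hloca : ∀ y, H.Adj a y → c₁.toSubgraph.Adj a y ∨ p.toSubgraph.Adj a y := by
    intro y hy
    rcases (hadj a y).1 hy with h | h | h
    · exact .inl h
    · exact .inr h
    · exact absurd (hvert h) hac₂
  have hlocb : ∀ y, H.Adj b y → c₂.toSubgraph.Adj b y ∨ p.reverse.toSubgraph.Adj b y := by
    intro y hy
    rw [Walk.toSubgraph_reverse]
    rcases (hadj b y).1 hy with h | h | h
    · exact absurd (hvert h) hbc₁
    · exact .inr h
    · exact .inl h
  have hfirst : G.Adj a c₁.snd := c₁.adj_snd hc₁.not_nil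
  have hpath : G.Adj a p.snd := p.adj_snd hpnil
  set e₁ : G.edgeSet := ⟨s(a, c₁.snd), G.mem_edgeSet.2 hfirst⟩ with he₁
  set e₂ : G.edgeSet := ⟨s(a, p.snd), G.mem_edgeSet.2 hpath⟩ with he₂
  have hpathval : ∀ z : G.edgeSet → ℤ, (graphMatrix G).mulVec z = 0 →
      (∀ e : G.edgeSet, z e ≠ 0 → (e : Sym2 V) ∈ H.edgeSet) → z e₂ = -2 * z e₁ := by
    intro z hz hzH
    have := two_mul_add_eq_zero hz hzH hc₁ hodd₁ hp hp1 hpa hloc₁ hloca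
    rw [← extendEdges_apply z e₁, ← extendEdges_apply z e₂]
    linarith
  -- Rank one: the value on `e₁` propagates around `c₁`, through `a` to the path, and through `b` to
  -- `c₂`.
  have hvanish : ∀ z : G.edgeSet → ℤ, (graphMatrix G).mulVec z = 0 →
      (∀ e : G.edgeSet, z e ≠ 0 → (e : Sym2 V) ∈ H.edgeSet) → z e₁ = 0 → z = 0 := by
    intro z hz hzH hz0
    have hz0' := hpathval z hz hzH
    rw [hz0, mul_zero] at hz0'
    have alt₁ := cycle_alternation hz hzH hc₁ hloc₁
    have altp := path_alternation hz hzH hp hlocp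
    have alt₂ := cycle_alternation hz hzH hc₂ hloc₂
    have hD₁ : extendEdges z s(c₁.getVert 0, c₁.getVert 1) = 0 := by
      rw [Walk.getVert_zero, ← hz0]
      exact extendEdges_apply z e₁
    have hDp : extendEdges z s(p.getVert 0, p.getVert 1) = 0 := by
      rw [Walk.getVert_zero, ← hz0']
      exact extendEdges_apply z e₂
    have hlast := altp (p.length - 1) (by omega)
    rw [hDp, mul_zero, Nat.sub_add_cancel hp1, Walk.getVert_length, Sym2.eq_swap] at hlast
    have hD₂ := two_mul_add_eq_zero (p := p.reverse) hz hzH hc₂ hodd₂ hp.reverse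
      (by rwa [Walk.length_reverse])
      (fun x hx hx' => hpb x (by simpa using hx) hx') hloc₂ hlocb
    rw [Walk.snd_reverse] at hD₂
    change extendEdges z s(b, p.penultimate) = 0 at hlast
    have hD₂' : extendEdges z s(c₂.getVert 0, c₂.getVert 1) = 0 := by
      rw [Walk.getVert_zero]
      change extendEdges z s(b, c₂.snd) = 0
      linarith
    funext e
    by_contra hze
    have heH := hzH e hze
    rw [Pi.zero_apply, ← extendEdges_apply z e] at hze
    obtain ⟨e, heG⟩ := e
    induction e using Sym2.ind with
    | _ x y =>
      rw [Subgraph.mem_edgeSet, hadj] at heH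
      rcases heH with h | h | h
      all_goals
        obtain ⟨i, hi, hlt⟩ := (Walk.toSubgraph_adj_iff _).1 h
        apply hze
        simp only
        rw [← hi]
      · rw [alt₁ i hlt, hD₁, mul_zero]
      · rw [altp i hlt, hDp, mul_zero]
      · rw [alt₂ i hlt, hD₂', mul_zero]
  -- The even closed walk that runs around both cycles and twice along the path.
  set W : G.Walk a a := c₁.append (p.append (c₂.append p.reverse)) with hW
  have hWeven : Even W.length := by
    simp only [hW, Walk.length_append, Walk.length_reverse]
    grind
  have hWedges : ∀ e ∈ W.edges, e ∈ H.edgeSet := by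
    intro e he
    rw [hHeq, Subgraph.edgeSet_sup, Subgraph.edgeSet_sup]
    simp only [hW, Walk.edges_append, List.mem_append, Walk.edges_reverse, List.mem_reverse] at he
    simp only [Set.mem_union, Walk.mem_edges_toSubgraph]
    tauto
  have hmd := multidegree_eq_of_even_closed W hWeven
  set u₀ := (altExponents W).1 with hu₀
  set v₀ := (altExponents W).2 with hv₀
  have he₁W : (u₀ e₁ : ℤ) - v₀ e₁ = 1 := by
    refine altExponents_append_sub hc₁ e₁ rfl ?_
    simp only [Walk.edges_append, List.mem_append, Walk.edges_reverse, List.mem_reverse]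
    have hnp : (e₁ : Sym2 V) ∉ p.edges := fun h =>
      hfirst.ne (hpa _ (p.snd_mem_support_of_mem_edges h) (c₁.getVert_mem_support 1)).symm
    have hnc : (e₁ : Sym2 V) ∉ c₂.edges := fun h => hac₂ (c₂.fst_mem_support_of_mem_edges h)
    tauto
  -- Truncated subtraction makes the supports disjoint without any study of the positions at which
  -- path edges recur.
  set u := u₀ - v₀ with hu
  set v := v₀ - u₀ with hv
  have huv_apply : ∀ e, (u e : ℤ) - v e = u₀ e - v₀ e := by
    intro e
    rw [hu, hv, Finsupp.tsub_apply, Finsupp.tsub_apply]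
    omega
  have huv : multidegree (graphMatrix G) u = multidegree (graphMatrix G) v := by
    have h1 : u + v₀ = v + u₀ := by
      ext e
      have := huv_apply e
      rw [Finsupp.add_apply, Finsupp.add_apply]
      omega
    have h2 := congrArg (multidegree (graphMatrix G)) h1
    rw [multidegree_add, multidegree_add, hmd] at h2
    exact add_right_cancel h2
  have hdisj' : ∀ e, u e = 0 ∨ v e = 0 := by
    intro e
    rw [hu, hv, Finsupp.tsub_apply, Finsupp.tsub_apply]
    omega
  have hne : u ≠ v := by
    intro h
    have := huv_apply e₁
    rw [h] at this
    omega
  have hz₀ : (graphMatrix G).mulVec (fun e => (u e : ℤ) - v e) = 0 := by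
    have : (fun e => (u e : ℤ) - v e) = (fun e => (u e : ℤ)) - fun e => (v e : ℤ) := rfl
    rw [this, Matrix.mulVec_sub, ← multidegree_eq_mulVec, ← multidegree_eq_mulVec, huv, sub_self]
  have huH : ∀ e : G.edgeSet, u e ≠ 0 ∨ v e ≠ 0 → (e : Sym2 V) ∈ H.edgeSet := by
    intro e he
    apply hWedges
    rw [mem_edges_iff_altExponents, ← hu₀, ← hv₀]
    rw [hu, hv, Finsupp.tsub_apply, Finsupp.tsub_apply] at he
    omega
  have hz₀H : ∀ e : G.edgeSet, (u e : ℤ) - v e ≠ 0 → (e : Sym2 V) ∈ H.edgeSet := by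
    intro e he
    apply huH
    omega
  -- Inducedness enters here: a column of `A_f` is an edge of `G` between vertices of `H`, hence an
  -- edge of `H`.
  have hTH : ∀ e ∈ columnsIn (graphMatrix G) (dividingVars (graphMatrix G) u),
      (e : Sym2 V) ∈ H.edgeSet := by
    rintro ⟨e, heG⟩ he
    induction e using Sym2.ind with
    | _ x y =>
      have hmem : ∀ w ∈ s(x, y), w ∈ H.verts := by
        intro w hw
        have h1 : 1 ≤ multidegree (graphMatrix G) u w := (he w).2 (by
          rw [graphMatrix_apply, if_pos hw]
          exact one_ne_zero)
        obtain ⟨e', hue', hwe'⟩ := exists_edge_of_multidegree_pos (G := G) (u := u) (x := w)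
          (by omega)
        exact H.mem_verts_of_mem_edge (huH e' (.inl hue')) hwe'
      exact hind (hmem x (by simp)) (hmem y (by simp)) (G.mem_edgeSet.1 heG)
  have huT : ∀ e, u e ≠ 0 → e ∈ columnsIn (graphMatrix G) (dividingVars (graphMatrix G) u) := by
    intro e he x
    refine ⟨graphMatrix_nonneg x e, fun hx => ?_⟩
    rw [graphMatrix_apply] at hx
    have := le_multidegree u (of_not_not fun h => hx (if_neg h))
    change 1 ≤ multidegree (graphMatrix G) u x
    omega
  have hvT : ∀ e, v e ≠ 0 → e ∈ columnsIn (graphMatrix G) (dividingVars (graphMatrix G) u) := by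
    intro e he x
    refine ⟨graphMatrix_nonneg x e, fun hx => ?_⟩
    rw [graphMatrix_apply] at hx
    have := le_multidegree v (of_not_not fun h => hx (if_neg h))
    change 1 ≤ multidegree (graphMatrix G) u x
    rw [huv]
    omega
  have hker : ∀ q r : G.edgeSet →₀ ℕ,
      (∀ e, q e ≠ 0 → e ∈ columnsIn (graphMatrix G) (dividingVars (graphMatrix G) u)) →
      (∀ e, r e ≠ 0 → e ∈ columnsIn (graphMatrix G) (dividingVars (graphMatrix G) u)) →
      multidegree (graphMatrix G) q = multidegree (graphMatrix G) r →
      ∃ k : ℤ, ∀ e, (q e : ℤ) - r e = k * (u e - v e) := by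
    intro q r hq hr hqr
    refine ⟨q e₁ - r e₁, fun e => ?_⟩
    have h0 := hvanish (((fun e => (q e : ℤ)) - fun e => (r e : ℤ)) -
      ((q e₁ : ℤ) - r e₁) • fun e => (u e : ℤ) - v e) (by
        rw [Matrix.mulVec_sub, Matrix.mulVec_sub, Matrix.mulVec_smul, hz₀,
          ← multidegree_eq_mulVec, ← multidegree_eq_mulVec, hqr]
        simp) (by
        intro e he
        by_contra hcon
        have hq0 : q e = 0 := by
          by_contra h
          exact hcon (hTH e (hq e h))
        have hr0 : r e = 0 := by
          by_contra h
          exact hcon (hTH e (hr e h))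
        have huv0 : (u e : ℤ) - v e = 0 := by
          by_contra h
          exact hcon (hz₀H e h)
        apply he
        simp [hq0, hr0, huv0]) (by simp [huv_apply, he₁W])
    have h1 := congrFun h0 e
    simp only [Pi.sub_apply, Pi.smul_apply, smul_eq_mul, Pi.zero_apply] at h1
    linarith
  refine ⟨monomialDiff K u v, ⟨isCircuit_monomialDiff hne huT hvT hdisj' huv hker, ?_⟩,
    monomialDiff_mem_iff.2 huv, u, v, hne, rfl,
    toricIdeal_submatrix_eq_span huT hvT hdisj' huv hker⟩
  rintro ⟨-, u', v', he, hu', hv'⟩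
  -- Since the value on `e₁` is 1, the value on `e₂` is -2, so one of the monomials is divisible by
  -- a square.
  have hval := hpathval _ hz₀ hz₀H
  have h1 := huv_apply e₁
  rw [he₁W] at h1
  simp only [h1] at hval
  rcases monomialDiff_eq_iff hne he with ⟨rfl, rfl⟩ | ⟨rfl, rfl⟩
  · have := hv' e₂
    omega
  · have := hu' e₂
    omega

end InducedOddCycles

/-! ### Linked pairs and the consequences for generators and redundancy. -/

section GraphIdeals

open MvPolynomial

variable {V : Type*} {G : SimpleGraph V} {K : Type*} [Field K]

lemma monomialDiff_add_monomialDiff {ι : Type*} (u v w : ι →₀ ℕ) :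
    monomialDiff K u v + monomialDiff K v w = monomialDiff K u w := by
  simp [monomialDiff]

/-- If the monomials `X ^ u` and `X ^ w` have a common variable and the same multidegree, their
difference is a multiple of a binomial of smaller degree. -/
lemma exists_monomialDiff_eq_mul {ι κ : Type*} {A : Matrix κ ι ℤ} {u w : ι →₀ ℕ} {j : ι}
    (hu : u j ≠ 0) (hw : w j ≠ 0) (huw : multidegree A u = multidegree A w) :
    ∃ u' w' m : ι →₀ ℕ, multidegree A u' = multidegree A w' ∧ u'.degree < u.degree ∧
      monomialDiff K u w = monomial m 1 * monomialDiff K u' w' := by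
  obtain ⟨u', rfl⟩ := exists_add_of_le (Finsupp.single_le_iff.2 (Nat.one_le_iff_ne_zero.2 hu))
  obtain ⟨w', rfl⟩ := exists_add_of_le (Finsupp.single_le_iff.2 (Nat.one_le_iff_ne_zero.2 hw))
  refine ⟨u', w', Finsupp.single j 1, ?_, ?_, (monomial_mul_monomialDiff _ _ _).symm⟩
  · rw [multidegree_add, multidegree_add] at huw
    exact add_left_cancel huw
  · rw [map_add, Finsupp.degree_single]
    omega

/-- A linking `w` gives `u - v = (u - w) + (w - v)`, where each summand has a variable that cancels.
-/
lemma exists_link [Finite V] {u v : G.edgeSet →₀ ℕ}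
    (huv : multidegree (graphMatrix G) u = multidegree (graphMatrix G) v) (h : ¬ Unlinked u v) :
    ∃ u₁ w₁ m₁ u₂ w₂ m₂ : G.edgeSet →₀ ℕ,
      multidegree (graphMatrix G) u₁ = multidegree (graphMatrix G) w₁ ∧ u₁.degree < u.degree ∧
      multidegree (graphMatrix G) u₂ = multidegree (graphMatrix G) w₂ ∧ u₂.degree < u.degree ∧
      monomialDiff K u v = monomial m₁ 1 * monomialDiff K u₁ w₁ +
        monomial m₂ 1 * monomialDiff K u₂ w₂ := by
  rw [Unlinked, not_and] at h
  have h := h huv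
  push Not at h
  obtain ⟨w, hw, e, e', hue, hwe, hve', hwe'⟩ := h
  obtain ⟨u₁, w₁, m₁, hd₁, hlt₁, he₁⟩ := exists_monomialDiff_eq_mul (K := K) hue hwe hw.symm
  obtain ⟨u₂, w₂, m₂, hd₂, hlt₂, he₂⟩ := exists_monomialDiff_eq_mul (K := K) hwe' hve'
    (hw.trans huv)
  rw [degree_eq_of_multidegree_eq hw] at hlt₂
  exact ⟨u₁, w₁, m₁, u₂, w₂, m₂, hd₁, hlt₁, hd₂, hlt₂, by
    rw [← he₁, ← he₂, monomialDiff_add_monomialDiff]⟩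

lemma toricIdeal_eq_span_squarefreeCircuits [Finite V]
    (hG : ¬ ∃ H : G.Subgraph, H.IsInduced ∧ IsOddCyclesWithPath H) :
    toricIdeal K (graphMatrix G) = Ideal.span (squarefreeCircuits K (graphMatrix G)) := by
  apply le_antisymm
  · rw [← isBinomialGenerators_homogeneousBinomials.2, Ideal.span_le]
    have key : ∀ n, ∀ u v : G.edgeSet →₀ ℕ, u.degree = n →
        multidegree (graphMatrix G) u = multidegree (graphMatrix G) v →
        monomialDiff K u v ∈ Ideal.span (squarefreeCircuits K (graphMatrix G)) := by
      intro n
      induction n using Nat.strong_induction_on with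
      | _ n ih =>
        rintro u v rfl huv
        by_cases hne : u = v
        · subst hne
          simp [monomialDiff]
        by_cases h : Unlinked u v
        · refine Ideal.subset_span (h.mem_squarefreeCircuits K hne fun a b ha hb => ?_)
          by_contra hab
          exact hG (h.exists_isOddCyclesWithPath hab ha hb)
        · obtain ⟨u₁, w₁, m₁, u₂, w₂, m₂, hd₁, hlt₁, hd₂, hlt₂, he⟩ := exists_link (K := K) huv h
          rw [he]
          exact add_mem (Ideal.mul_mem_left _ _ (ih _ hlt₁ u₁ w₁ rfl hd₁))
            (Ideal.mul_mem_left _ _ (ih _ hlt₂ u₂ w₂ rfl hd₂))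
    rintro f ⟨u, v, _, hd, rfl⟩
    exact key _ u v rfl hd
  · rw [Ideal.span_le]
    exact fun f hf => hf.1.2.1

lemma isRedundant_of_notMem_squarefreeCircuits [Finite V]
    (hG : ¬ ∃ H : G.Subgraph, H.IsInduced ∧ IsOddCyclesWithPath H) {f : MvPolynomial G.edgeSet K}
    (hf : f ∈ circuits K (graphMatrix G) \ squarefreeCircuits K (graphMatrix G)) :
    IsRedundant (graphMatrix G) f := by
  obtain ⟨⟨⟨u, v, hne, rfl⟩, hI, hirr⟩, hsf⟩ := hf
  have huv := monomialDiff_mem_iff.1 hI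
  have h : ¬ Unlinked u v := by
    intro h
    refine hsf (h.mem_squarefreeCircuits K hne fun a b ha hb => ?_)
    by_contra hab
    exact hG (h.exists_isOddCyclesWithPath hab ha hb)
  obtain ⟨u₁, w₁, m₁, u₂, w₂, m₂, hd₁, hlt₁, hd₂, hlt₂, he⟩ := exists_link (K := K) huv h
  refine isRedundant_of_mem_span (fun _ _ => degree_eq_of_multidegree_eq) hne ?_
  nth_rewrite 1 [he]
  exact add_mem (Ideal.mul_mem_left _ _ (Ideal.subset_span ⟨u₁, w₁, hd₁, hlt₁, rfl⟩))
    (Ideal.mul_mem_left _ _ (Ideal.subset_span ⟨u₂, w₂, hd₂, hlt₂, rfl⟩))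

/-- The squarefree circuits would be a system of binomial generators; they are closed under
negation, so neither `f` nor `-f` belongs to it. -/
lemma not_isIndispensable_of_toricIdeal_eq
    (h : toricIdeal K (graphMatrix G) = Ideal.span (squarefreeCircuits K (graphMatrix G)))
    {f : MvPolynomial G.edgeSet K}
    (hf : f ∈ circuits K (graphMatrix G) \ squarefreeCircuits K (graphMatrix G)) :
    ¬ IsIndispensable (graphMatrix G) f := by
  rintro ⟨-, -, hind⟩
  rcases hind _ ⟨fun g hg => hg.1.1, h.symm⟩ with h1 | ⟨h1, u, v, he, hu, hv⟩
  · exact hf.2 h1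
  · exact hf.2 ⟨hf.1, v, u, by rw [← neg_monomialDiff, ← he, neg_neg], hv, hu⟩

end GraphIdeals

end Toric

theorem theorem2p6 {K : Type*} [Field K] {V : Type*} [Finite V]
    (G : SimpleGraph V) (hG : G.Connected) :
    List.TFAE [
      Toric.toricIdeal K (Toric.graphMatrix G) =
        Ideal.span (Toric.squarefreeCircuits K (Toric.graphMatrix G)),
      ∀ f ∈ Toric.circuits K (Toric.graphMatrix G) \
          Toric.squarefreeCircuits K (Toric.graphMatrix G),
        Toric.IsRedundant (Toric.graphMatrix G) f,
      ∀ f ∈ Toric.circuits K (Toric.graphMatrix G) \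
          Toric.squarefreeCircuits K (Toric.graphMatrix G),
        ¬ Toric.IsIndispensable (Toric.graphMatrix G) f,
      ∀ f ∈ Toric.circuits K (Toric.graphMatrix G) \
          Toric.squarefreeCircuits K (Toric.graphMatrix G),
        ¬ Toric.IsFundamental (Toric.graphMatrix G) f,
      ¬ ∃ H : G.Subgraph, H.IsInduced ∧ Toric.IsOddCyclesWithPath H] := by
  tfae_have 1 → 3 := fun h f hf => Toric.not_isIndispensable_of_toricIdeal_eq h hf
  tfae_have 2 → 3 := fun h f hf hind => hind.not_isRedundant (h f hf)
  tfae_have 3 → 4 := fun h f hf hfund => h f hf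
    (hfund.isIndispensable Toric.graphMatrix_nonneg fun _ _ => Toric.degree_eq_of_multidegree_eq)
  tfae_have 4 → 5 := by
    rintro h ⟨H, hind, hH⟩
    obtain ⟨f, hf, hfund⟩ := Toric.exists_isFundamental_of_isOddCyclesWithPath K hind hH
    exact h f hf hfund
  tfae_have 5 → 1 := fun h => Toric.toricIdeal_eq_span_squarefreeCircuits h
  tfae_have 5 → 2 := fun h f hf => Toric.isRedundant_of_notMem_squarefreeCircuits h hf
  tfae_finish
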